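/- Let $d\ge 1$, let $\Lambda=A\mathbb Z^d\subset\mathbb R^d$ be a lattice with $A$ nonsingular, with columns $v_1,\dots,v_d$. Let $\Omega_\Lambda=\{\sum_j\alpha_jv_j:\alpha_j\in[0,1)\}$, which represents the flat torus $\mathbb R^d/\Lambda$, let $\mu$ be the normalized Lebesgue measure on $\Omega_\Lambda$, and let $\Lambda^*=\{w\in\mathbb R^d:\langle w,v\rangle\in\mathbb Z\ \text{for all}\ v\in\Lambda\}$ be the dual lattice. Let $c_0,c_1>0$, let $\mathcal N\subseteq\mathbb N$ be infinite, and for each $N\in\mathcal N$ let $\mathcal D_N\subset\mathbb R^d$ be an open set whose boundary has Lebesgue measure zero, such that $B(0;c_0N^{1/d})\subseteq\mathcal D_N\subseteq B(0;c_0N^{1/d}+c_1)$ and $\#(\Lambda^*\cap\mathcal D_N)=N$. Let $X_N$ be a determinantal point process on the torus with kernel $$K_N(x,y)=\sum_{w\in\Lambda^*\cap\mathcal D_N}e^{2\pi i\langle x-y,w\rangle},$$ that is, a simple point process whose joint intensities with respect to $\mu$ are $\det(K_N(x_i,x_j))_{1\le i,j\le k}$ for every $k\ge1$. Define the number variance by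 $$V(X_N,R)=\int_{\Omega_\Lambda}\mathbb E\Big(\#\big(X_N\cap B_\Lambda(x,R)\big)-N\mu\big(B_\Lambda(x,R)\big)\Big)^2d\mu(x),$$ where $B_\Lambda(x,R)$ is the closed ball of radius $R$ about $x$ in the torus $\mathbb R^d/\Lambda$. Then, as $N\to\infty$ within $\mathcal N$: 1. (large balls) $V(X_N,R)=o(N)$ for every $R\in(0,\tfrac12\operatorname{diam}\Omega_\Lambda)$; 2. (small balls) $V(X_N,R_N)=o\big(N\,\mathrm{Vol}(B(0,R_N))\big)$ for every sequence of radii with $R_N\to0$ and $N\,\mathrm{Vol}(B(0,R_N))\to\infty$; 3. (threshold regime) $\limsup_{N\to\infty}V(X_N,tN^{-1/d})=O(t^{d-1}\ln t)$ as $t\to\infty$. -/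

import Mathlib

open MeasureTheory Filter Topology
open scoped ENNReal NNReal

noncomputable section

namespace FlatTorus

/-- The Euclidean space `ℝ^d`. -/
abbrev Space (d : ℕ) : Type := EuclideanSpace ℝ (Fin d)

/-- The lattice `Λ = A ℤ^d` generated by the columns `v₁, …, v_d` of a nonsingular matrix `A`,
that is, by a basis of `ℝ^d`. -/
def lattice {d : ℕ} (b : Module.Basis (Fin d) ℝ (Space d)) : Set (Space d) :=
  {v | v ∈ Submodule.span ℤ (Set.range b)}

/-- The fundamental domain `Ω_Λ = {∑ αⱼ vⱼ : αⱼ ∈ [0, 1)}`, which represents `ℝ^d / Λ`. -/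
def Omega {d : ℕ} (b : Module.Basis (Fin d) ℝ (Space d)) : Set (Space d) :=
  ZSpan.fundamentalDomain b

/-- The dual lattice `Λ* = {w : ⟨w, v⟩ ∈ ℤ for all v ∈ Λ}`. -/
def dualLattice {d : ℕ} (b : Module.Basis (Fin d) ℝ (Space d)) : Set (Space d) :=
  {w | ∀ v ∈ lattice b, ∃ n : ℤ, inner ℝ w v = (n : ℝ)}

/-- The normalized Lebesgue measure `μ` on the flat torus, carried by `Ω_Λ`. -/
def mu {d : ℕ} (b : Module.Basis (Fin d) ℝ (Space d)) : Measure (Space d) :=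
  (volume (Omega b))⁻¹ • volume.restrict (Omega b)

/-- The closed ball with centre `x` and radius `R` of the flat torus `ℝ^d / Λ`, as a subset of
`Ω_Λ`: the points `y` which have a translate `y + v`, `v ∈ Λ`, at Euclidean distance at most `R`
from `x`. -/
def torusBall {d : ℕ} (b : Module.Basis (Fin d) ℝ (Space d)) (x : Space d) (R : ℝ) :
    Set (Space d) :=
  {y | y ∈ Omega b ∧ ∃ v ∈ lattice b, dist x (y + v) ≤ R}

/-- The number of points of a finite configuration in a set. -/
def count {d : ℕ} (X : Finset (Space d)) (D : Set (Space d)) : ℕ :=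
  ((X : Set (Space d)) ∩ D).ncard

/-- A simple point process on the flat torus: a random finite subset of `Ω_Λ`, such that the
numbers of points in Borel sets are random variables. -/
structure IsSimplePointProcess {d : ℕ} (b : Module.Basis (Fin d) ℝ (Space d))
    {S : Type*} [MeasurableSpace S] (X : S → Finset (Space d)) : Prop where
  subset_Omega : ∀ ω, (X ω : Set (Space d)) ⊆ Omega b
  measurable_count : ∀ D : Set (Space d), MeasurableSet D → Measurable fun ω => count (X ω) D

/-- `ρ` is the joint intensity of order `k` of the point process `X` with respect to the background
measure `μ`: for pairwise disjoint Borel sets `D₁, …, D_k`, the expectation of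
`∏ #(X ∩ Dᵢ)` is the integral of `ρ` over `D₁ × ⋯ × D_k`. -/
def IsJointIntensity {d : ℕ} (b : Module.Basis (Fin d) ℝ (Space d))
    {S : Type*} [MeasurableSpace S] (P : Measure S) (X : S → Finset (Space d))
    (k : ℕ) (ρ : (Fin k → Space d) → ℝ≥0) : Prop :=
  ∀ D : Fin k → Set (Space d), (∀ i, MeasurableSet (D i)) →
    Pairwise (fun i j => Disjoint (D i) (D j)) →
      ∫⁻ ω, ∏ i, (count (X ω) (D i) : ℝ≥0∞) ∂P =
        ∫⁻ x in Set.univ.pi D, (ρ x : ℝ≥0∞) ∂(Measure.pi fun _ : Fin k => mu b)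

/-- `X` is a determinantal point process on the flat torus with kernel `K`: it is simple, and its
joint intensities are `ρ_k(x₁, …, x_k) = det (K(xᵢ, xⱼ))` for every `k ≥ 1`. -/
structure IsDeterminantal {d : ℕ} (b : Module.Basis (Fin d) ℝ (Space d))
    (K : Space d → Space d → ℂ)
    {S : Type*} [MeasurableSpace S] (P : Measure S) (X : S → Finset (Space d)) : Prop where
  simple : IsSimplePointProcess b X
  intensity : ∀ k : ℕ, 1 ≤ k → ∃ ρ : (Fin k → Space d) → ℝ≥0,
    (∀ x : Fin k → Space d, (∀ i, x i ∈ Omega b) →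
      (Matrix.of fun i j => K (x i) (x j)).det = ((ρ x : ℝ) : ℂ)) ∧
    IsJointIntensity b P X k ρ

/-- The kernel `K(x, y) = ∑_{w ∈ Λ* ∩ 𝒟} e^{2π i ⟨x - y, w⟩}`. -/
def kernel {d : ℕ} (b : Module.Basis (Fin d) ℝ (Space d)) (𝒟 : Set (Space d))
    (x y : Space d) : ℂ :=
  ∑ᶠ w ∈ dualLattice b ∩ 𝒟,
    Complex.exp (2 * Real.pi * Complex.I * ((inner ℝ (x - y) w : ℝ) : ℂ))

/-- The number variance `V(X, R)` of a process `X` of `N` points, for balls of radius `R`: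
the integral over all centres `x` of the expectation of `(#(X ∩ B(x, R)) - N μ(B(x, R)))²`. -/
def numberVariance {d : ℕ} (b : Module.Basis (Fin d) ℝ (Space d))
    {S : Type*} [MeasurableSpace S] (P : Measure S) (X : S → Finset (Space d))
    (N : ℕ) (R : ℝ) : ℝ≥0∞ :=
  ∫⁻ x, ∫⁻ ω, ENNReal.ofReal
    (((count (X ω) (torusBall b x R) : ℝ) - (N : ℝ) * (mu b).real (torusBall b x R)) ^ 2) ∂P ∂(mu b)

/-- `N → ∞` within the index set `A`. -/
def toInfinity (A : Set ℕ) : Filter ℕ := atTop ⊓ 𝓟 A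

/-- Hyperuniformity for large balls of a sequence with number variances `V N R`, `N ∈ A`:
`V N R = o(N)` for every `R ∈ (0, diam Ω_Λ / 2)`. -/
def HyperuniformLargeBalls {d : ℕ} (b : Module.Basis (Fin d) ℝ (Space d)) (A : Set ℕ)
    (V : ℕ → ℝ → ℝ≥0∞) : Prop :=
  ∀ R ∈ Set.Ioo (0 : ℝ) (Metric.diam (Omega b) / 2),
    Tendsto (fun N : ℕ => V N R / (N : ℝ≥0∞)) (toInfinity A) (𝓝 0)

/-- Hyperuniformity for small balls of a sequence with number variances `V N R`, `N ∈ A`: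
`V N (R_N) = o(N Vol(B(0, R_N)))` for all radii `R_N → 0` with `N Vol(B(0, R_N)) → ∞`. -/
def HyperuniformSmallBalls (d : ℕ) (A : Set ℕ) (V : ℕ → ℝ → ℝ≥0∞) : Prop :=
  ∀ r : ℕ → ℝ, Tendsto r (toInfinity A) (𝓝 0) →
    Tendsto (fun N : ℕ => (N : ℝ≥0∞) * volume (Metric.closedBall (0 : Space d) (r N)))
      (toInfinity A) (𝓝 ∞) →
    Tendsto (fun N : ℕ => V N (r N) / ((N : ℝ≥0∞) * volume (Metric.closedBall (0 : Space d) (r N))))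
      (toInfinity A) (𝓝 0)

/-- The threshold order property `limsup_{N → ∞} V N (t N^{-1/d}) = O(t^{d-1} ln t)`
as `t → ∞`. -/
def ThresholdLogBound (d : ℕ) (A : Set ℕ) (V : ℕ → ℝ → ℝ≥0∞) : Prop :=
  ∃ C : ℝ, ∀ᶠ t : ℝ in atTop,
    limsup (fun N : ℕ => V N (t * (N : ℝ) ^ (-(1 / (d : ℝ))))) (toInfinity A) ≤
      ENNReal.ofReal (C * (t ^ (d - 1) * Real.log t))

end FlatTorus

end

/-!
The proof is a second moment computation followed by one elementary expansion in sines.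

*Variance as a separation integral.* For a determinantal process whose kernel `K` is the kernel of a
projection, the variance of the number of points in `D` is at most the integral of `|K(y, z)|²` over
`y ∈ D`, `z ∉ D` (`FlatTorus.lintegral_count_sub_sq_le`). The joint intensities give
`E[#(X ∩ E) #(X ∩ E')]` for disjoint sets only; since `X` is a finite set of distinct points, the
cells of a fine partition eventually separate them, and Fatou's lemma yields the second moment
(`FlatTorus.lintegral_sq_count_le`). Integrating over the centres, `V(X, R)` is at most the integral
of `|K(y, z)|²` against the measure of the set of `x` whose ball of radius `R` contains `y` but
not `z`.

*Geometry.* That measure is `O(R ^ (d - 1) min(R, |z - y|))`, the distance being taken modulo the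
lattice. It is therefore `O(R ^ (d - 1))` times the sum, over the coordinates `α` of `z - y`, of
`min(R, ‖α‖)`, where `‖α‖` is the distance of `α` to the integers.

*Fourier expansion.* For `R ≤ 1/2`,
`min(R, ‖α‖) = ∑ m, 4 sin²(π m R) sin²(π m α) / (π² m²)`, with nonnegative coefficients that are at
most `4 R²` and at most `1 / m²` (`FlatTorus.hasSum_truncCoeff_mul_sin_sq`). By orthogonality of the
characters, the integral of `|K(y, z)|² sin²(π ⟨z - y, η⟩)` in `z` is half the number of frequencies
`w ∈ Λ* ∩ 𝒟` with `w + η ∉ 𝒟` (`FlatTorus.lintegral_sq_norm_kernel_mul_sin_sq`). For `η` equal to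
`m` times a vector of the dual basis, and `n = N ^ (1 / d)`, these lie in a shell of radius `O(n)`
and thickness `O(m)`, so that by packing there are `O(n ^ (d - 1) min(m, n))` of them
(`FlatTorus.exists_card_escape_le`).

*Conclusion.* Summation over `m` gives `V(X, R) = O(s ^ (d - 1) (1 + log⁺ s))` with `s = n R`,
uniformly in `N ≥ 1` and `R > 0` (`FlatTorus.exists_numberVariance_le`); the logarithm is the
harmonic sum over `1 / R ≤ m ≤ n`. Since the expected number of points in a ball is of order
`s ^ d`, this bound contains all three regimes.
-/

namespace FlatTorus

/-! ### Sine expansion of the truncated distance to the integers -/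

theorem hasSum_one_sub_cos_div_sq {x : ℝ} (hx : x ∈ Set.Icc (0 : ℝ) 1) :
    HasSum (fun n : ℕ => (1 - Real.cos (2 * Real.pi * n * x)) / (n : ℝ) ^ 2)
      (Real.pi ^ 2 * (x * (1 - x))) := by
  have h := hasSum_one_div_nat_pow_mul_cos one_ne_zero hx
  have h2 := hasSum_zeta_two.sub h
  convert! h2 using 1
  · ext n
    simp only [mul_one]
    ring
  · have hb : (Polynomial.map (algebraMap ℚ ℝ) (Polynomial.bernoulli 2)).eval x =
        x ^ 2 - x + 6⁻¹ := bernoulliFun_two x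
    simp only [mul_one, Nat.factorial_two, hb]
    push_cast
    ring

/-- The `m`-th coefficient of the sine expansion of the truncated distance to the nearest
integer. -/
noncomputable def truncCoeff (R : ℝ) (m : ℕ) : ℝ :=
  4 * Real.sin (Real.pi * m * R) ^ 2 / (Real.pi ^ 2 * (m : ℝ) ^ 2)

theorem truncCoeff_nonneg (R : ℝ) (m : ℕ) : 0 ≤ truncCoeff R m := by
  unfold truncCoeff; positivity

theorem sin_sq_pi_mul_abs_sub_round (m : ℕ) (x : ℝ) :
    Real.sin (Real.pi * m * |x - round x|) ^ 2 = Real.sin (Real.pi * m * x) ^ 2 := by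
  have h : Real.sin (Real.pi * m * (x - round x)) ^ 2 = Real.sin (Real.pi * m * x) ^ 2 := by
    have : Real.pi * m * (x - round x) = Real.pi * m * x - ((m * round x : ℤ) : ℝ) * Real.pi := by
      push_cast; ring
    rw [this, Real.sin_sub_int_mul_pi, mul_pow]
    rcases Int.even_or_odd (m * round x) with h | h <;> simp [h.neg_one_zpow]
  rcases abs_cases (x - (round x : ℝ)) with ⟨h1, _⟩ | ⟨h1, _⟩
  · rw [h1, h]
  · rw [h1, mul_neg, Real.sin_neg, neg_sq, h]

/-- The expansion of the truncated distance to the nearest integer. Its coefficients are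
nonnegative because `R - min R |x|` is a triangle function, which is positive definite. -/
theorem hasSum_truncCoeff_mul_sin_sq {R : ℝ} (hR0 : 0 ≤ R) (hR : R ≤ 1 / 2) (x : ℝ) :
    HasSum (fun m : ℕ => truncCoeff R m * Real.sin (Real.pi * m * x) ^ 2)
      (min R |x - round x|) := by
  simp_rw [← sin_sq_pi_mul_abs_sub_round _ x]
  set a := |x - round x| with ha
  have ha0 : 0 ≤ a := abs_nonneg _
  have ha1 : a ≤ 1 / 2 := abs_sub_round x
  have hd0 : 0 ≤ |R - a| := abs_nonneg _
  have hd1 : |R - a| ≤ 1 := abs_le.2 ⟨by linarith, by linarith⟩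
  have h1 := hasSum_one_sub_cos_div_sq (x := R) ⟨hR0, by linarith⟩
  have h2 := hasSum_one_sub_cos_div_sq (x := a) ⟨ha0, by linarith⟩
  have h3 := hasSum_one_sub_cos_div_sq (x := R + a) ⟨by linarith, by linarith⟩
  have h4 := hasSum_one_sub_cos_div_sq (x := |R - a|) ⟨hd0, hd1⟩
  have h := (((h1.add h2).sub (h3.mul_left (1 / 2))).sub (h4.mul_left (1 / 2))).mul_left
    (1 / Real.pi ^ 2)
  have hpi := Real.pi_pos
  convert! h using 1
  · ext m
    have e4 : Real.cos (2 * Real.pi * m * |R - a|) = Real.cos (2 * Real.pi * m * (R - a)) := by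
      rcases abs_cases (R - a) with ⟨h1, _⟩ | ⟨h1, _⟩
      · rw [h1]
      · rw [h1, mul_neg, Real.cos_neg]
    have e1 : Real.cos (2 * Real.pi * m * R) = 1 - 2 * Real.sin (Real.pi * m * R) ^ 2 := by
      rw [← Real.cos_two_mul_eq_one_sub]; congr 1; ring
    have e2 : Real.cos (2 * Real.pi * m * a) = 1 - 2 * Real.sin (Real.pi * m * a) ^ 2 := by
      rw [← Real.cos_two_mul_eq_one_sub]; congr 1; ring
    have e3 : Real.cos (2 * Real.pi * m * (R + a)) + Real.cos (2 * Real.pi * m * (R - a))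
        = 2 * Real.cos (2 * Real.pi * m * R) * Real.cos (2 * Real.pi * m * a) := by
      rw [mul_add, mul_sub, Real.cos_add, Real.cos_sub]; ring
    rw [e4]
    unfold truncCoeff
    rcases Nat.eq_zero_or_pos m with rfl | hm
    · simp
    have hm' : (m : ℝ) ≠ 0 := by positivity
    have e5 := eq_sub_of_add_eq e3
    rw [e5, e1, e2]
    field_simp
    ring
  · rcases abs_cases (R - a) with ⟨h1, h1'⟩ | ⟨h1, h1'⟩
    · rw [h1, min_eq_right (by linarith)]; field_simp; ring
    · rw [h1, min_eq_left (by linarith)]; field_simp; ring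

theorem truncCoeff_le_four_mul_sq (R : ℝ) (m : ℕ) : truncCoeff R m ≤ 4 * R ^ 2 := by
  unfold truncCoeff
  have hpi := Real.pi_pos
  rcases Nat.eq_zero_or_pos m with rfl | hm
  · simp; positivity
  have hm' : (0 : ℝ) < m := by positivity
  rw [div_le_iff₀ (by positivity)]
  have h : Real.sin (Real.pi * m * R) ^ 2 ≤ (Real.pi * m * R) ^ 2 :=
    Real.sin_sq_le_sq
  nlinarith

theorem truncCoeff_le_one_div_sq (R : ℝ) (m : ℕ) : truncCoeff R m ≤ 1 / (m : ℝ) ^ 2 := by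
  unfold truncCoeff
  have hpi := Real.pi_gt_three
  rcases Nat.eq_zero_or_pos m with rfl | hm
  · simp
  have hm' : (0 : ℝ) < m := by positivity
  rw [div_le_div_iff₀ (by positivity) (by positivity)]
  have h := Real.sin_sq_le_one (Real.pi * m * R)
  have : 4 * Real.sin (Real.pi * m * R) ^ 2 ≤ Real.pi ^ 2 := by nlinarith
  nlinarith [sq_nonneg (m : ℝ)]

/-- The terms with `m ≤ 1 / R`, with `1 / R ≤ m ≤ n`, and with `m ≥ n` contribute `O(1)`,
a harmonic sum `O(log (n R))`, and `O(1)`. -/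
theorem sum_range_truncCoeff_mul_min_le {R n : ℝ} (hR0 : 0 < R) (hR : R ≤ 1 / 2) (hn : 1 ≤ n)
    (M : ℕ) :
    ∑ m ∈ Finset.range M, truncCoeff R m * min (m : ℝ) n ≤ 14 + Real.log (max 1 (n * R)) := by
  set t : ℕ → ℝ := fun m => truncCoeff R m * min (m : ℝ) n with ht
  have ht0 : ∀ m, 0 ≤ t m := fun m =>
    mul_nonneg (truncCoeff_nonneg _ _) (le_min (by positivity) (by linarith))
  -- the two thresholds at which the dominant bound on the terms changes
  set p := ⌈1 / R⌉₊ with hp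
  set q := max p ⌈n⌉₊ with hq
  have hp1 : 1 / R ≤ p := Nat.le_ceil _
  have hp2 : (p : ℝ) < 1 / R + 1 := Nat.ceil_lt_add_one (by positivity)
  have hppos : 1 ≤ p := Nat.one_le_iff_ne_zero.2 (by
    intro h; rw [h] at hp1; have : 0 < 1 / R := by positivity
    simp at hp1; linarith)
  have hppos' : (1 : ℝ) ≤ p := by exact_mod_cast hppos
  have hpq : p ≤ q := le_max_left _ _
  have hqn : n ≤ q := (Nat.le_ceil n).trans (by exact_mod_cast le_max_right _ _)
  have hRp : R * p ≤ 1 + R := by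
    have := mul_le_mul_of_nonneg_left hp2.le hR0.le
    rwa [mul_add, mul_one_div_cancel hR0.ne', mul_one] at this
  have phase1 : ∑ m ∈ Finset.range (p + 1), t m ≤ 12 := by
    have : ∀ m ∈ Finset.range (p + 1), t m ≤ 6 * R := by
      intro m hm
      have hmp : (m : ℝ) ≤ p := by exact_mod_cast Nat.lt_succ_iff.1 (Finset.mem_range.1 hm)
      calc t m ≤ 4 * R ^ 2 * p :=
            mul_le_mul (truncCoeff_le_four_mul_sq R m) ((min_le_left _ _).trans hmp)
              (le_min (by positivity) (by linarith)) (by positivity)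
        _ ≤ 6 * R := by nlinarith
    have h := Finset.sum_le_card_nsmul _ _ _ this
    rw [Finset.card_range, nsmul_eq_mul] at h
    push_cast at h
    nlinarith
  have phase2 : ∀ k, p ≤ k → k ≤ q →
      ∑ m ∈ Finset.range (k + 1), t m ≤ 12 + Real.log (k / p) := by
    intro k hk
    induction k, hk using Nat.le_induction with
    | base => intro _; rw [div_self (by positivity), Real.log_one]; linarith
    | succ k hk ih =>
      intro hkq
      rw [Finset.sum_range_succ]
      have hk0 : (0 : ℝ) < k := by exact_mod_cast (by omega : 0 < k)
      have h1 : t (k + 1) ≤ 1 / ((k : ℝ) + 1) := by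
        have h2 := truncCoeff_le_one_div_sq R (k + 1)
        calc t (k + 1) ≤ 1 / ((k + 1 : ℕ) : ℝ) ^ 2 * ((k + 1 : ℕ) : ℝ) :=
              mul_le_mul h2 (min_le_left _ _) (le_min (by positivity) (by linarith))
                (by positivity)
          _ = 1 / ((k : ℝ) + 1) := by push_cast; field_simp
      have h3 : 1 / ((k : ℝ) + 1) ≤ Real.log ((k + 1) / k) := by
        have := Real.one_sub_inv_le_log_of_pos (x := ((k : ℝ) + 1) / k) (by positivity)
        refine le_trans (le_of_eq ?_) this
        field_simp; ring
      have h4 : Real.log (((k + 1 : ℕ) : ℝ) / p) = Real.log (k / p) + Real.log ((k + 1) / k) := by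
        rw [← Real.log_mul (by positivity) (by positivity)]
        congr 1; push_cast; field_simp
      rw [h4]
      linarith [ih (by omega)]
  have phase3 : ∀ k, q ≤ k →
      ∑ m ∈ Finset.range (k + 1), t m ≤ 12 + Real.log (q / p) + n * (1 / q - 1 / k) := by
    intro k hk
    induction k, hk using Nat.le_induction with
    | base => simpa using phase2 q hpq le_rfl
    | succ k hk ih =>
      rw [Finset.sum_range_succ]
      have hk0 : (0 : ℝ) < k := by exact_mod_cast (by omega : 0 < k)
      have h1 : t (k + 1) ≤ n * (1 / k - 1 / ((k + 1 : ℕ) : ℝ)) := by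
        have h2 := truncCoeff_le_one_div_sq R (k + 1)
        calc t (k + 1) ≤ 1 / ((k + 1 : ℕ) : ℝ) ^ 2 * n :=
              mul_le_mul h2 (min_le_right _ _) (le_min (by positivity) (by linarith))
                (by positivity)
          _ ≤ n * (1 / k - 1 / ((k + 1 : ℕ) : ℝ)) := by
            rw [mul_comm]
            refine mul_le_mul_of_nonneg_left ?_ (by linarith)
            push_cast
            rw [div_sub_div _ _ (by positivity) (by positivity),
              div_le_div_iff₀ (by positivity) (by positivity)]
            nlinarith
      linarith
  have hqpos : (1 : ℝ) ≤ q := hn.trans hqn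
  have hmx : (1 : ℝ) ≤ max 1 (n * R) := le_max_left _ _
  have hqp : (q : ℝ) / p ≤ 2 * max 1 (n * R) := by
    rw [div_le_iff₀ (by positivity), hq, Nat.cast_max]
    have hRp1 : 1 ≤ R * p := by
      have := mul_le_mul_of_nonneg_left hp1 hR0.le
      rwa [mul_one_div_cancel hR0.ne'] at this
    refine max_le (by nlinarith) ?_
    calc ((⌈n⌉₊ : ℕ) : ℝ) ≤ 2 * n := by linarith [Nat.ceil_lt_add_one (a := n) (by linarith)]
      _ ≤ 2 * n * (R * p) := by nlinarith
      _ = 2 * (n * R) * p := by ring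
      _ ≤ 2 * max 1 (n * R) * p := by gcongr; exact le_max_right _ _
  have hlog : Real.log (q / p) ≤ 1 + Real.log (max 1 (n * R)) := by
    calc Real.log (q / p) ≤ Real.log (2 * max 1 (n * R)) :=
          Real.log_le_log (by positivity) hqp
      _ = Real.log 2 + Real.log (max 1 (n * R)) := Real.log_mul (by norm_num) (by positivity)
      _ ≤ _ := by linarith [Real.log_two_lt_d9]
  calc ∑ m ∈ Finset.range M, t m ≤ ∑ m ∈ Finset.range (max M q + 1), t m :=
        Finset.sum_le_sum_of_subset_of_nonneg
          (Finset.range_mono (by omega)) fun m _ _ => ht0 m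
    _ ≤ 12 + Real.log (q / p) + n * (1 / q - 1 / (max M q : ℕ)) := phase3 _ (le_max_right _ _)
    _ ≤ 12 + Real.log (q / p) + n * (1 / q) := by
        have : (0 : ℝ) ≤ 1 / ((max M q : ℕ) : ℝ) := by positivity
        gcongr; linarith
    _ ≤ 12 + Real.log (q / p) + 1 := by
        gcongr; rw [mul_one_div, div_le_one (by positivity)]; exact hqn
    _ ≤ _ := by linarith

/-! ### Shells, packing, and the dual lattice -/

section

theorem pow_sub_max_pow_le {d : ℕ} (hd : 1 ≤ d) {a c : ℝ} (ha : 0 ≤ a) (hca : c ≤ a) :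
    a ^ d - max c 0 ^ d ≤ d * a ^ (d - 1) * (a - c) := by
  set e := max c 0 with he
  have he0 : 0 ≤ e := le_max_right _ _
  have hea : e ≤ a := max_le hca ha
  have h1 : a ^ d - e ^ d ≤ d * a ^ (d - 1) * (a - e) := by
    rw [← Commute.mul_geom_sum₂ (Commute.all a e), mul_comm]
    refine mul_le_mul_of_nonneg_right ?_ (by linarith)
    calc ∑ i ∈ Finset.range d, a ^ i * e ^ (d - 1 - i)
        ≤ ∑ i ∈ Finset.range d, a ^ (d - 1) := by
          refine Finset.sum_le_sum fun i hi => ?_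
          have hi' := Finset.mem_range.1 hi
          calc a ^ i * e ^ (d - 1 - i) ≤ a ^ i * a ^ (d - 1 - i) := by gcongr
            _ = a ^ (d - 1) := by rw [← pow_add]; congr 1; omega
      _ = d * a ^ (d - 1) := by simp
  refine h1.trans (mul_le_mul_of_nonneg_left ?_ (by positivity))
  linarith [le_max_left c 0]

/-- The volume of a shell; a negative inner radius `c` is allowed, and then the inner ball is
empty. -/
theorem volume_shell_le {d : ℕ} (hd : 1 ≤ d) (y : Space d) {a c : ℝ} (ha : 0 ≤ a) (hca : c ≤ a) :
    volume (Metric.closedBall y a \ Metric.ball y c) ≤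
      ENNReal.ofReal (d * a ^ (d - 1) * (a - c)) * volume (Metric.ball (0 : Space d) 1) := by
  have he : Metric.ball y c = Metric.ball y (max c 0) := by
    rcases le_total c 0 with h | h
    · rw [max_eq_right h, Metric.ball_zero, Metric.ball_eq_empty.2 h]
    · rw [max_eq_left h]
  have : Nonempty (Fin d) := ⟨⟨0, hd⟩⟩
  rw [he, measure_sdiff ((Metric.ball_subset_ball (max_le hca ha)).trans
    Metric.ball_subset_closedBall) measurableSet_ball.nullMeasurableSet measure_ball_lt_top.ne,
    Measure.addHaar_closedBall _ _ ha, Measure.addHaar_ball _ _ (le_max_right _ _),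
    finrank_euclideanSpace_fin, ← ENNReal.sub_mul (fun _ _ => measure_ball_lt_top.ne),
    ← ENNReal.ofReal_sub _ (by positivity)]
  gcongr
  exact pow_sub_max_pow_le hd ha hca

theorem volume_closedBall_sdiff_closedBall_le {d : ℕ} (hd : 1 ≤ d) (y u : Space d) {R : ℝ}
    (hR : 0 ≤ R) :
    volume (Metric.closedBall y R \ Metric.closedBall (y + u) R) ≤
      ENNReal.ofReal (d * R ^ (d - 1) * min R ‖u‖) * volume (Metric.ball (0 : Space d) 1) := by
  -- every point outside the second ball has distance at least `R - ‖u‖` from `y`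
  have h := volume_shell_le hd y (c := R - min R ‖u‖) hR
    (by linarith [le_min hR (norm_nonneg u)])
  rw [sub_sub_cancel] at h
  refine (measure_mono ?_).trans h
  refine Set.sdiff_subset_sdiff_right fun x hx => ?_
  rw [Metric.mem_ball] at hx
  rw [Metric.mem_closedBall]
  rcases le_total R ‖u‖ with h1 | h1
  · rw [min_eq_left h1, sub_self] at hx
    exact absurd dist_nonneg (not_le.2 hx)
  · rw [min_eq_right h1] at hx
    have := dist_triangle x y (y + u)
    rw [dist_self_add_right] at this
    linarith

/-- Disjoint balls of radius `ε` about the points of a `2 ε`-separated set in a shell fit into a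
slightly thicker shell. -/
theorem card_mul_pow_le_of_separated {d : ℕ} (hd : 1 ≤ d) {ε a c : ℝ} (hε : 0 < ε) (ha : 0 ≤ a)
    (hca : c ≤ a) (F : Finset (Space d))
    (hsep : ∀ u ∈ F, ∀ v ∈ F, u ≠ v → 2 * ε ≤ dist u v) (hF : ∀ u ∈ F, c ≤ ‖u‖ ∧ ‖u‖ ≤ a) :
    (F.card : ℝ) * ε ^ d ≤ d * (a + ε) ^ (d - 1) * (a - c + 2 * ε) := by
  have hdis : (F : Set (Space d)).PairwiseDisjoint fun u => Metric.ball u ε := by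
    intro u hu v hv huv
    exact Metric.ball_disjoint_ball (by linarith [hsep u hu v hv huv])
  have : Nonempty (Fin d) := ⟨⟨0, hd⟩⟩
  have h1 := measure_biUnion_finset (μ := volume) hdis fun u _ => measurableSet_ball
  have h2 : volume (⋃ u ∈ F, Metric.ball u ε) ≤
      volume (Metric.closedBall (0 : Space d) (a + ε) \ Metric.ball 0 (c - ε)) := by
    refine measure_mono (Set.iUnion₂_subset fun u hu x hx => ?_)
    obtain ⟨h3, h4⟩ := hF u hu
    rw [Metric.mem_ball, dist_eq_norm] at hx
    have h5 := norm_sub_norm_le u x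
    have h6 := norm_sub_norm_le x u
    rw [norm_sub_rev] at h5
    simp only [Set.mem_sdiff, mem_closedBall_zero_iff, mem_ball_zero_iff, not_lt]
    constructor <;> linarith
  have h3 := h2.trans (volume_shell_le hd 0 (by linarith) (by linarith))
  rw [h1] at h3
  simp only [Measure.addHaar_ball _ _ hε.le, finrank_euclideanSpace_fin, Finset.sum_const,
    nsmul_eq_mul] at h3
  rw [← mul_assoc, ENNReal.mul_le_mul_iff_left (Metric.measure_ball_pos _ _ one_pos).ne'
    measure_ball_lt_top.ne, ← ENNReal.ofReal_natCast, ← ENNReal.ofReal_mul (by positivity),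
    ENNReal.ofReal_le_ofReal_iff (by
      have : 0 ≤ a + ε - (c - ε) := by linarith
      positivity)] at h3
  refine h3.trans (le_of_eq ?_)
  ring

variable {d : ℕ} (b : Module.Basis (Fin d) ℝ (Space d))

/-- The `j`-th vector of the basis dual to `b` with respect to the inner product. -/
noncomputable def dualVector (j : Fin d) : Space d :=
  (InnerProductSpace.toDual ℝ (Space d)).symm (LinearMap.toContinuousLinearMap (b.coord j))

theorem inner_dualVector (j : Fin d) (x : Space d) : inner ℝ (dualVector b j) x = b.repr x j := by
  simp [dualVector]

theorem exists_int_repr_eq {v : Space d} (hv : v ∈ lattice b) (j : Fin d) :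
    ∃ n : ℤ, b.repr v j = n := by
  obtain ⟨n, hn⟩ := (b.mem_span_iff_repr_mem ℤ v).1 hv j
  exact ⟨n, by simpa using hn.symm⟩

theorem zero_mem_dualLattice : (0 : Space d) ∈ dualLattice b := fun v _ => ⟨0, by simp⟩

theorem mem_dualLattice_add {u v : Space d} (hu : u ∈ dualLattice b) (hv : v ∈ dualLattice b) :
    u + v ∈ dualLattice b := by
  intro x hx
  obtain ⟨m, hm⟩ := hu x hx
  obtain ⟨n, hn⟩ := hv x hx
  exact ⟨m + n, by rw [inner_add_left, hm, hn]; push_cast; ring⟩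

theorem mem_dualLattice_sub {u v : Space d} (hu : u ∈ dualLattice b) (hv : v ∈ dualLattice b) :
    u - v ∈ dualLattice b := by
  intro x hx
  obtain ⟨m, hm⟩ := hu x hx
  obtain ⟨n, hn⟩ := hv x hx
  exact ⟨m - n, by rw [inner_sub_left, hm, hn]; push_cast; ring⟩

theorem smul_dualVector_mem_dualLattice (m : ℕ) (j : Fin d) :
    (m : ℝ) • dualVector b j ∈ dualLattice b := by
  intro x hx
  obtain ⟨n, hn⟩ := exists_int_repr_eq b hx j
  exact ⟨m * n, by rw [real_inner_smul_left, inner_dualVector, hn]; push_cast; ring⟩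

theorem basis_mem_lattice (j : Fin d) : b j ∈ lattice b :=
  Submodule.subset_span (Set.mem_range_self j)

theorem eq_of_inner_basis_eq {u v : Space d} (h : ∀ j, inner ℝ u (b j) = (inner ℝ v (b j) : ℝ)) :
    u = v :=
  InnerProductSpace.ext_inner_right_basis b h

/-- Distinct points of the dual lattice have distinct integral inner products with some basis
vector. -/
theorem exists_dualLattice_separation :
    ∃ ε : ℝ, 0 < ε ∧ ∀ u ∈ dualLattice b, ∀ v ∈ dualLattice b, u ≠ v → 2 * ε ≤ dist u v := by
  have hS : 0 ≤ ∑ j, ‖b j‖ := Finset.sum_nonneg fun j _ => norm_nonneg _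
  refine ⟨(2 * (1 + ∑ j, ‖b j‖))⁻¹, by positivity, fun u hu v hv huv => ?_⟩
  by_contra! hlt
  refine huv (eq_of_inner_basis_eq b fun j => ?_)
  obtain ⟨m, hm⟩ := mem_dualLattice_sub b hu hv (b j) (basis_mem_lattice b j)
  have h1 : |(m : ℝ)| < 1 := by
    rw [← hm]
    refine (abs_real_inner_le_norm _ _).trans_lt ?_
    rw [← dist_eq_norm]
    have h2 : ‖b j‖ ≤ ∑ j, ‖b j‖ :=
      Finset.single_le_sum (f := fun j => ‖b j‖) (fun j _ => norm_nonneg _) (Finset.mem_univ j)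
    rw [mul_inv, ← mul_assoc, mul_inv_cancel₀ two_ne_zero, one_mul] at hlt
    calc dist u v * ‖b j‖ ≤ (1 + ∑ j, ‖b j‖)⁻¹ * ∑ j, ‖b j‖ := by gcongr
      _ < 1 := by rw [inv_mul_lt_iff₀ (by positivity)]; linarith
  have h3 : m = 0 := by
    rw [← Int.cast_abs] at h1
    exact Int.abs_lt_one_iff.1 (by exact_mod_cast h1)
  rw [h3, Int.cast_zero, inner_sub_left] at hm
  linarith

/-- The frequencies `w ∈ F` that leave `F` under the translation by `η`. -/
noncomputable def escape (F : Finset (Space d)) (η : Space d) : Finset (Space d) :=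
  open Classical in F.filter fun w => w + η ∉ F

theorem escape_zero (F : Finset (Space d)) : escape F (0 : Space d) = ∅ := by
  refine Finset.filter_eq_empty_iff.2 fun w hw => ?_
  simp [hw]

/-- The points of the dual lattice that leave `𝒟` under a translation by `m` times a fixed vector
lie in a shell of thickness `O(m)` about the sphere of radius `c₀ n`. -/
theorem exists_card_escape_le (hd : 1 ≤ d) {c₀ c₁ : ℝ} (hc₀ : 0 < c₀) (hc₁ : 0 < c₁) :
    ∃ C : ℝ, 0 < C ∧ ∀ n : ℝ, 1 ≤ n → ∀ 𝒟 : Set (Space d), Metric.ball 0 (c₀ * n) ⊆ 𝒟 →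
      𝒟 ⊆ Metric.ball 0 (c₀ * n + c₁) → ∀ F : Finset (Space d), (F : Set _) = dualLattice b ∩ 𝒟 →
      (F.card : ℝ) = n ^ d → ∀ (m : ℕ) (j : Fin d),
      ((escape F ((m : ℝ) • dualVector b j)).card : ℝ) ≤ C * n ^ (d - 1) * min (m : ℝ) n := by
  obtain ⟨ε, hε, hsep⟩ := exists_dualLattice_separation b
  set L := ∑ j, ‖dualVector b j‖ with hL
  have hL0 : 0 ≤ L := Finset.sum_nonneg fun j _ => norm_nonneg _
  set C := d * (c₀ + c₁ + ε) ^ (d - 1) * (c₁ + L + 2 * ε) / ε ^ d with hC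
  have hC0 : 0 ≤ C := by positivity
  refine ⟨max 1 C, by positivity, fun n hn 𝒟 h1 h2 F hF hcard m j => ?_⟩
  set G := escape F ((m : ℝ) • dualVector b j) with hG
  have hGF : G ⊆ F := Finset.filter_subset _ _
  have hmemF : ∀ w, w ∈ F ↔ w ∈ dualLattice b ∧ w ∈ 𝒟 := fun w => by
    rw [← Finset.mem_coe, hF]; rfl
  have hn0 : 0 < n := by linarith
  have hnd : n ^ d = n ^ (d - 1) * n := by rw [← pow_succ]; congr 1; omega
  rcases Nat.eq_zero_or_pos m with hm | hm
  · have : G = ∅ := by rw [hG, hm, Nat.cast_zero, zero_smul, escape_zero]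
    rw [this, Finset.card_empty, Nat.cast_zero]
    positivity
  have hm1 : (1 : ℝ) ≤ m := by exact_mod_cast hm
  rw [mul_min_of_nonneg _ _ (by positivity)]
  refine le_min ?_ ?_
  · have h3 : (G.card : ℝ) * ε ^ d ≤
        d * (c₀ * n + c₁ + ε) ^ (d - 1) * (c₀ * n + c₁ - (c₀ * n - m * L) + 2 * ε) := by
      have hmL : 0 ≤ m * L := by positivity
      refine card_mul_pow_le_of_separated hd hε (by positivity) (by linarith) G
        (fun u hu v hv => hsep u ((hmemF u).1 (hGF hu)).1 v ((hmemF v).1 (hGF hv)).1)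
        fun u hu => ⟨?_, ?_⟩
      · have hu1 := ((hmemF u).1 (hGF hu)).1
        have hu2 : u + (m : ℝ) • dualVector b j ∉ F := (Finset.mem_filter.1 hu).2
        have hu3 : u + (m : ℝ) • dualVector b j ∉ Metric.ball 0 (c₀ * n) := fun h =>
          hu2 ((hmemF _).2
            ⟨mem_dualLattice_add b hu1 (smul_dualVector_mem_dualLattice b m j), h1 h⟩)
        rw [mem_ball_zero_iff, not_lt] at hu3
        have hj : ‖dualVector b j‖ ≤ L := Finset.single_le_sum
          (f := fun j => ‖dualVector b j‖) (fun j _ => norm_nonneg _) (Finset.mem_univ j)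
        have h4 := norm_add_le u ((m : ℝ) • dualVector b j)
        rw [norm_smul, Real.norm_natCast] at h4
        nlinarith
      · have := h2 ((hmemF u).1 (hGF hu)).2
        rw [mem_ball_zero_iff] at this
        exact this.le
    have h4 : (G.card : ℝ) ≤ C * n ^ (d - 1) * m := by
      rw [← mul_le_mul_iff_of_pos_right (show 0 < ε ^ d by positivity)]
      refine h3.trans ?_
      have h5 : c₀ * n + c₁ + ε ≤ (c₀ + c₁ + ε) * n := by nlinarith
      have h6 : c₀ * n + c₁ - (c₀ * n - m * L) + 2 * ε ≤ (c₁ + L + 2 * ε) * m := by nlinarith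
      calc d * (c₀ * n + c₁ + ε) ^ (d - 1) * (c₀ * n + c₁ - (c₀ * n - m * L) + 2 * ε)
          ≤ d * ((c₀ + c₁ + ε) * n) ^ (d - 1) * ((c₁ + L + 2 * ε) * m) :=
            mul_le_mul (by gcongr) h6 (by have : 0 ≤ m * L := by positivity
                                          linarith) (by positivity)
        _ = C * n ^ (d - 1) * m * ε ^ d := by
          rw [hC, mul_pow]; field_simp
    refine h4.trans ?_
    gcongr
    exact le_max_right _ _
  · calc (G.card : ℝ) ≤ F.card := by exact_mod_cast Finset.card_le_card hGF
      _ = 1 * n ^ (d - 1) * n := by rw [hcard, hnd, one_mul]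
      _ ≤ _ := by gcongr; exact le_max_left _ _

end

/-! ### Balls of the torus that separate two points -/

section

variable {d : ℕ} (b : Module.Basis (Fin d) ℝ (Space d))

theorem measurableSet_Omega : MeasurableSet (Omega b) := ZSpan.fundamentalDomain_measurableSet b

theorem volume_Omega_ne_zero : volume (Omega b) ≠ 0 := ZSpan.measure_fundamentalDomain_ne_zero b

theorem volume_Omega_ne_top : volume (Omega b) ≠ ∞ :=
  (ZSpan.fundamentalDomain_isBounded b).measure_lt_top.ne

instance isProbabilityMeasure_mu : IsProbabilityMeasure (mu b) := by
  refine ⟨?_⟩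
  rw [mu, Measure.smul_apply, Measure.restrict_apply_univ, smul_eq_mul,
    ENNReal.inv_mul_cancel (volume_Omega_ne_zero b) (volume_Omega_ne_top b)]

theorem ae_mem_Omega : ∀ᵐ x ∂(mu b), x ∈ Omega b :=
  Measure.ae_smul_measure (ae_restrict_mem (measurableSet_Omega b)) _

instance countable_span_toAddSubgroup :
    Countable (Submodule.span ℤ (Set.range b)).toAddSubgroup :=
  inferInstanceAs (Countable (Submodule.span ℤ (Set.range b)))

theorem countable_lattice : (lattice b).Countable := by
  have : Countable (Submodule.span ℤ (Set.range b)) := inferInstance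
  exact Set.countable_coe_iff.1 this

theorem mem_lattice_iff {v : Space d} :
    v ∈ lattice b ↔ v ∈ Submodule.span ℤ (Set.range b) := Iff.rfl

theorem add_mem_lattice {u v : Space d} (hu : u ∈ lattice b) (hv : v ∈ lattice b) :
    u + v ∈ lattice b :=
  (Submodule.span ℤ (Set.range b)).add_mem hu hv

theorem measurableSet_mem_torusBall (R : ℝ) :
    MeasurableSet {p : Space d × Space d | p.2 ∈ torusBall b p.1 R} := by
  have : {p : Space d × Space d | p.2 ∈ torusBall b p.1 R} =
      (Prod.snd ⁻¹' Omega b) ∩ ⋃ v ∈ lattice b, {p | dist p.1 (p.2 + v) ≤ R} := by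
    ext p
    simp [torusBall]
  rw [this]
  refine (measurable_snd (measurableSet_Omega b)).inter
    (MeasurableSet.biUnion (countable_lattice b) fun v _ => ?_)
  exact (isClosed_le (by fun_prop) continuous_const).measurableSet

theorem measurableSet_torusBall (x : Space d) (R : ℝ) : MeasurableSet (torusBall b x R) :=
  measurable_prodMk_left (measurableSet_mem_torusBall b R)

/-- Modulo the lattice, a centre whose ball contains `y` but not `z` lies in the difference of two
Euclidean balls of radius `R` whose centres differ by `z - y + l`. -/
theorem mu_torusBall_separates_le (hd : 1 ≤ d) {R : ℝ} (hR : 0 ≤ R) (y : Space d) {z l : Space d}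
    (hz : z ∈ Omega b) (hl : l ∈ lattice b) :
    mu b {x | y ∈ torusBall b x R ∧ z ∉ torusBall b x R} ≤ (volume (Omega b))⁻¹ *
      (ENNReal.ofReal (d * R ^ (d - 1) * min R ‖z - y + l‖) *
        volume (Metric.ball (0 : Space d) 1)) := by
  set S := Metric.closedBall y R \ Metric.closedBall (y + (z - y + l)) R with hS
  set T := {x | y ∈ torusBall b x R ∧ z ∉ torusBall b x R} with hT
  rw [mu, Measure.smul_apply, smul_eq_mul]
  gcongr
  refine le_trans ?_ (volume_closedBall_sdiff_closedBall_le hd y (z - y + l) hR)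
  have hF := ZSpan.isAddFundamentalDomain' b (volume : Measure (Space d))
  rw [hF.measure_eq_tsum S, Measure.restrict_apply' (measurableSet_Omega b)]
  refine le_trans (measure_mono ?_) (measure_iUnion_le _)
  rintro x ⟨⟨⟨_, v, hv, hv1⟩, hx2⟩, hx3⟩
  refine Set.mem_iUnion.2 ⟨⟨v, hv⟩, ?_, hx3⟩
  refine Set.mem_vadd_set.2 ⟨x - v, ⟨?_, fun h => hx2 ⟨hz, l + v, add_mem_lattice b hl hv, ?_⟩⟩, ?_⟩
  · rw [Metric.mem_closedBall, dist_eq_norm]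
    rw [dist_eq_norm] at hv1
    rwa [sub_right_comm, sub_sub]
  · rw [Metric.mem_closedBall, dist_eq_norm] at h
    rw [dist_eq_norm]
    convert h using 2
    abel
  · change v + (x - v) = x
    abel

/-- The distance of `x` to the lattice, truncated at `R`, is controlled by the truncated distances
of its coordinates to the integers; `l` rounds the coordinates. The truncation at `1 / 2` on the
right is free, and makes the sine expansion applicable. -/
theorem exists_lattice_min_norm_add_le {R : ℝ} (hR : 0 ≤ R) (x : Space d) :
    ∃ l ∈ lattice b, min R ‖x + l‖ ≤ (1 + ∑ j, ‖b j‖) *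
      ∑ j, min (min R (1 / 2)) |b.repr x j - round (b.repr x j)| := by
  set a : Fin d → ℝ := fun j => b.repr x j - round (b.repr x j) with ha
  have hK : 0 ≤ ∑ j, ‖b j‖ := Finset.sum_nonneg fun j _ => norm_nonneg _
  have hmin : ∀ j, min (min R (1 / 2)) |a j| = min R |a j| := fun j => by
    rw [min_assoc, min_eq_right (abs_sub_round _)]
  refine ⟨-∑ j, round (b.repr x j) • b j, ?_, ?_⟩
  · exact Submodule.neg_mem _ (Submodule.sum_mem _ fun j _ =>
      Submodule.smul_mem _ _ ((mem_lattice_iff b).1 (basis_mem_lattice b j)))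
  have hx : x + -∑ j, round (b.repr x j) • b j = ∑ j, a j • b j := by
    conv_lhs => rw [← b.sum_repr x]
    rw [← sub_eq_add_neg, ← Finset.sum_sub_distrib]
    refine Finset.sum_congr rfl fun j _ => ?_
    rw [ha, sub_smul, ← Int.cast_smul_eq_zsmul ℝ, b.sum_repr x]
  rw [hx]
  change _ ≤ _ * ∑ j, min (min R (1 / 2)) |a j|
  simp_rw [hmin]
  have hnn : ∀ j, 0 ≤ min R |a j| := fun j => le_min hR (abs_nonneg _)
  have hsum := Finset.sum_nonneg fun j (_ : j ∈ Finset.univ) => hnn j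
  by_cases h : ∃ j, R ≤ |a j|
  · obtain ⟨j, hj⟩ := h
    have h1 : R ≤ ∑ j, min R |a j| := by
      calc R = min R |a j| := (min_eq_left hj).symm
        _ ≤ _ := Finset.single_le_sum (f := fun j => min R |a j|) (fun j _ => hnn j)
          (Finset.mem_univ j)
    calc _ ≤ R := min_le_left _ _
      _ ≤ _ := by nlinarith
  · push Not at h
    calc _ ≤ ‖∑ j, a j • b j‖ := min_le_right _ _
      _ ≤ ∑ j, ‖a j • b j‖ := norm_sum_le _ _
      _ ≤ ∑ j, (1 + ∑ j, ‖b j‖) * min R |a j| := by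
        refine Finset.sum_le_sum fun j _ => ?_
        rw [norm_smul, min_eq_right (h j).le, Real.norm_eq_abs, mul_comm]
        gcongr
        have := Finset.single_le_sum (f := fun j => ‖b j‖) (fun j _ => norm_nonneg _)
          (Finset.mem_univ j)
        linarith
      _ = _ := by rw [Finset.mul_sum]

/-- The measure of the centres whose ball separates `y` from `z`, bounded by a nonnegative
combination of squared sines in the frequencies `m • dualVector b j`. -/
theorem exists_mu_torusBall_separates_le_tsum (hd : 1 ≤ d) :
    ∃ C : ℝ, 0 < C ∧ ∀ R : ℝ, 0 ≤ R → ∀ y z : Space d, z ∈ Omega b →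
      mu b {x | y ∈ torusBall b x R ∧ z ∉ torusBall b x R} ≤
        ENNReal.ofReal (C * R ^ (d - 1)) * ∑ j, ∑' m : ℕ,
          ENNReal.ofReal (truncCoeff (min R (1 / 2)) m) *
          ENNReal.ofReal (Real.sin (Real.pi * inner ℝ (z - y) ((m : ℝ) • dualVector b j)) ^ 2) := by
  set v := ((volume (Omega b))⁻¹ * volume (Metric.ball (0 : Space d) 1)).toReal with hv
  have hvt : (volume (Omega b))⁻¹ * volume (Metric.ball (0 : Space d) 1) ≠ ∞ :=
    ENNReal.mul_ne_top (ENNReal.inv_ne_top.2 (volume_Omega_ne_zero b)) measure_ball_lt_top.ne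
  have : Nonempty (Fin d) := ⟨⟨0, hd⟩⟩
  have hv0 : 0 < v := ENNReal.toReal_pos (mul_ne_zero
    (ENNReal.inv_ne_zero.2 (volume_Omega_ne_top b)) (Metric.measure_ball_pos _ _ one_pos).ne') hvt
  have hK : 0 ≤ ∑ j, ‖b j‖ := Finset.sum_nonneg fun j _ => norm_nonneg _
  have hd0 : (0 : ℝ) < d := by exact_mod_cast hd
  refine ⟨v * d * (1 + ∑ j, ‖b j‖), by positivity, fun R hR y z hz => ?_⟩
  obtain ⟨l, hl, hl1⟩ := exists_lattice_min_norm_add_le b hR (z - y)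
  have hR' : 0 ≤ min R (1 / 2) := le_min hR (by norm_num)
  have hterm : ∀ j, ENNReal.ofReal
      (min (min R (1 / 2)) |b.repr (z - y) j - round (b.repr (z - y) j)|) =
      ∑' m : ℕ, ENNReal.ofReal (truncCoeff (min R (1 / 2)) m) *
          ENNReal.ofReal
            (Real.sin (Real.pi * inner ℝ (z - y) ((m : ℝ) • dualVector b j)) ^ 2) := by
    intro j
    have hs := hasSum_truncCoeff_mul_sin_sq hR' (min_le_right _ _) (b.repr (z - y) j)
    rw [← hs.tsum_eq, ENNReal.ofReal_tsum_of_nonneg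
      (fun m => mul_nonneg (truncCoeff_nonneg _ _) (sq_nonneg _)) hs.summable]
    refine tsum_congr fun m => ?_
    rw [ENNReal.ofReal_mul (truncCoeff_nonneg _ _), real_inner_smul_right, real_inner_comm,
      inner_dualVector, mul_assoc]
  calc _ ≤ _ := mu_torusBall_separates_le b hd hR y hz hl
    _ = ENNReal.ofReal (v * (d * R ^ (d - 1) * min R ‖z - y + l‖)) := by
      rw [ENNReal.ofReal_mul hv0.le, hv, ENNReal.ofReal_toReal hvt]; ring
    _ ≤ ENNReal.ofReal (v * d * (1 + ∑ j, ‖b j‖) * R ^ (d - 1) *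
        ∑ j, min (min R (1 / 2)) |b.repr (z - y) j - round (b.repr (z - y) j)|) := by
      refine ENNReal.ofReal_le_ofReal ?_
      calc _ ≤ v * (d * R ^ (d - 1) * ((1 + ∑ j, ‖b j‖) *
            ∑ j, min (min R (1 / 2)) |b.repr (z - y) j - round (b.repr (z - y) j)|)) := by gcongr
        _ = _ := by ring
    _ = _ := by
      rw [ENNReal.ofReal_mul (by positivity), ENNReal.ofReal_sum_of_nonneg
        fun j _ => le_min hR' (abs_nonneg _)]
      simp_rw [hterm]

end

/-! ### Characters and the kernel -/

section

variable {d : ℕ} (b : Module.Basis (Fin d) ℝ (Space d))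

/-- The character `x ↦ e^{2π i ⟨x, w⟩}`. -/
noncomputable def character (w x : Space d) : ℂ :=
  Complex.exp (2 * Real.pi * Complex.I * ((inner ℝ x w : ℝ) : ℂ))

theorem continuous_character (w : Space d) : Continuous (character w) := by
  unfold character
  fun_prop

theorem character_eq_exp_mul_I (w x : Space d) :
    character w x = Complex.exp ((2 * Real.pi * inner ℝ x w : ℝ) * Complex.I) := by
  unfold character; congr 1; push_cast; ring

theorem norm_character (w x : Space d) : ‖character w x‖ = 1 := by
  rw [character_eq_exp_mul_I, Complex.norm_exp_ofReal_mul_I]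

theorem re_character (w x : Space d) :
    (character w x).re = Real.cos (2 * Real.pi * inner ℝ x w) := by
  rw [character_eq_exp_mul_I, Complex.exp_ofReal_mul_I_re]

theorem character_add_left (w w' x : Space d) :
    character (w + w') x = character w x * character w' x := by
  simp only [character, ← Complex.exp_add, inner_add_right]
  congr 1; push_cast; ring

theorem character_add_right (w x y : Space d) :
    character w (x + y) = character w x * character w y := by
  simp only [character, ← Complex.exp_add, inner_add_left]
  congr 1; push_cast; ring

theorem star_character (w x : Space d) : star (character w x) = character (-w) x := by
  rw [character_eq_exp_mul_I, character_eq_exp_mul_I, Complex.star_def, ← Complex.exp_conj]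
  congr 1
  rw [map_mul, Complex.conj_ofReal, Complex.conj_I, inner_neg_right]
  push_cast
  ring

theorem character_of_mem_lattice {w v : Space d} (hw : w ∈ dualLattice b) (hv : v ∈ lattice b) :
    character w v = 1 := by
  obtain ⟨n, hn⟩ := hw v hv
  rw [character, real_inner_comm, hn, Complex.exp_eq_one_iff]
  exact ⟨n, by push_cast; ring⟩

theorem integral_character_of_ne_zero {w : Space d} (hw : w ∈ dualLattice b) (h0 : w ≠ 0) :
    ∫ z, character w z ∂(mu b) = 0 := by
  -- translation by `h` changes the sign of the character, but not its integral over the torus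
  set h : Space d := (2 * ‖w‖ ^ 2)⁻¹ • w with hh
  have hwn : ‖w‖ ≠ 0 := norm_ne_zero_iff.2 h0
  have h1 : character w h = -1 := by
    rw [character, hh, real_inner_smul_left, real_inner_self_eq_norm_sq, ← Complex.exp_pi_mul_I]
    congr 1
    have : (2 * ‖w‖ ^ 2)⁻¹ * ‖w‖ ^ 2 = (1 / 2 : ℝ) := by field_simp
    rw [this]; push_cast; ring
  have hF := ZSpan.isAddFundamentalDomain' b (volume : Measure (Space d))
  have hF' := hF.vadd_of_comm h
  have h2 : ∫ z in Omega b, character w z = ∫ z in (fun z => h + z) '' Omega b, character w z :=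
    hF.setIntegral_eq hF' (f := character w) (fun g x => by
      change character w ((g : Space d) + x) = _
      rw [character_add_right, character_of_mem_lattice b hw g.2, one_mul])
  have h3 : ∫ z in (fun z => h + z) '' Omega b, character w z =
      ∫ z in Omega b, character w (h + z) :=
    (measurePreserving_add_left volume h).setIntegral_image_emb
      (measurableEmbedding_addLeft h) _ _
  have h4 : ∫ z in Omega b, character w z = 0 := by
    rw [h3] at h2
    simp_rw [character_add_right, h1, neg_one_mul, integral_neg] at h2
    exact self_eq_neg.1 h2
  rw [mu, integral_smul_measure, h4, smul_zero]

theorem integral_character_sub {w : Space d} (hw : w ∈ dualLattice b) (y : Space d) :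
    ∫ z, character w (y - z) ∂(mu b) = open Classical in if w = 0 then 1 else 0 := by
  have h1 : ∀ z, character w (y - z) = character w y * star (character w z) := fun z => by
    have : character w (-z) = star (character w z) := by
      rw [star_character]; simp [character]
    rw [sub_eq_add_neg, character_add_right, this]
  simp_rw [h1]
  split_ifs with h
  · simp [h, character]
  · rw [integral_const_mul, Complex.star_def, integral_conj, integral_character_of_ne_zero b hw h]
    simp

theorem kernel_eq_sum {𝒟 : Set (Space d)} {F : Finset (Space d)}
    (hF : (F : Set (Space d)) = dualLattice b ∩ 𝒟) (x y : Space d) :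
    kernel b 𝒟 x y = ∑ w ∈ F, character w (x - y) := by
  rw [kernel, ← hF, finsum_mem_coe_finset]
  rfl

theorem continuous_kernel {𝒟 : Set (Space d)} {F : Finset (Space d)}
    (hF : (F : Set (Space d)) = dualLattice b ∩ 𝒟) :
    Continuous fun p : Space d × Space d => kernel b 𝒟 p.1 p.2 := by
  simp_rw [kernel_eq_sum b hF]
  exact continuous_finsetSum _ fun w _ =>
    (continuous_character w).comp (continuous_fst.sub continuous_snd)

theorem continuous_kernel_right {𝒟 : Set (Space d)} {F : Finset (Space d)}
    (hF : (F : Set (Space d)) = dualLattice b ∩ 𝒟) (x : Space d) :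
    Continuous fun y => kernel b 𝒟 x y := by
  simp_rw [kernel_eq_sum b hF]
  exact continuous_finsetSum _ fun w _ =>
    (continuous_character w).comp (continuous_const.sub continuous_id)

theorem norm_kernel_le {𝒟 : Set (Space d)} {F : Finset (Space d)}
    (hF : (F : Set (Space d)) = dualLattice b ∩ 𝒟) (x y : Space d) :
    ‖kernel b 𝒟 x y‖ ≤ F.card := by
  rw [kernel_eq_sum b hF]
  refine (norm_sum_le _ _).trans (le_of_eq ?_)
  simp [norm_character]

/-- Multiplication of the squared kernel by the character of `η` shifts the frequencies of one of
its two factors. -/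
theorem kernel_mul_star_mul_character {𝒟 : Set (Space d)} {F : Finset (Space d)}
    (hF : (F : Set (Space d)) = dualLattice b ∩ 𝒟) (y z η : Space d) :
    kernel b 𝒟 y z * star (kernel b 𝒟 y z) * character η (y - z) =
      ∑ w ∈ F, ∑ w' ∈ F, character (w + η - w') (y - z) := by
  rw [kernel_eq_sum b hF, star_sum, Finset.sum_mul_sum, Finset.sum_mul]
  refine Finset.sum_congr rfl fun w _ => ?_
  rw [Finset.sum_mul]
  refine Finset.sum_congr rfl fun w' _ => ?_
  rw [star_character, sub_eq_add_neg (w + η) w', character_add_left, character_add_left]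
  ring

theorem kernel_mul_star (𝒟 : Set (Space d)) (y z : Space d) :
    kernel b 𝒟 y z * star (kernel b 𝒟 y z) = ((‖kernel b 𝒟 y z‖ ^ 2 : ℝ) : ℂ) := by
  generalize kernel b 𝒟 y z = k
  rw [Complex.star_def, Complex.mul_conj, Complex.normSq_eq_norm_sq]

theorem integrable_character_sub (w y : Space d) :
    Integrable (fun z => character w (y - z)) (mu b) :=
  Integrable.of_bound (C := 1) (((continuous_character w).comp
    (continuous_const.sub continuous_id)).aestronglyMeasurable)
    (Eventually.of_forall fun z => (norm_character w (y - z)).le)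

theorem integral_kernel_mul_star_mul_character {𝒟 : Set (Space d)} {F : Finset (Space d)}
    (hF : (F : Set (Space d)) = dualLattice b ∩ 𝒟) (y : Space d) {η : Space d}
    (hη : η ∈ dualLattice b) :
    ∫ z, kernel b 𝒟 y z * star (kernel b 𝒟 y z) * character η (y - z) ∂(mu b) =
      (F.card : ℂ) - (escape F η).card := by
  classical
  have hmem : ∀ w ∈ F, w ∈ dualLattice b := fun w hw => by
    have : w ∈ (F : Set (Space d)) := hw
    rw [hF] at this
    exact this.1
  simp_rw [kernel_mul_star_mul_character b hF]
  rw [integral_finsetSum _ fun w _ => integrable_finsetSum _ fun w' _ =>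
    integrable_character_sub b _ _]
  have h1 : ∀ w ∈ F, ∫ z, ∑ w' ∈ F, character (w + η - w') (y - z) ∂(mu b) =
      if w + η ∈ F then 1 else 0 := by
    intro w hw
    rw [integral_finsetSum _ fun w' _ => integrable_character_sub b _ _]
    have h2 : ∀ w' ∈ F, ∫ z, character (w + η - w') (y - z) ∂(mu b) =
        if w + η = w' then 1 else 0 := by
      intro w' hw'
      rw [integral_character_sub b
        (mem_dualLattice_sub b (mem_dualLattice_add b (hmem w hw) hη) (hmem w' hw'))]
      simp only [sub_eq_zero]
    rw [Finset.sum_congr rfl h2, Finset.sum_ite_eq]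
  rw [Finset.sum_congr rfl h1, ← Finset.natCast_card_filter, eq_sub_iff_add_eq]
  unfold escape
  exact_mod_cast Finset.card_filter_add_card_filter_not (s := F) (fun w => w + η ∈ F)

/-- The squared kernel is orthogonal to all squared sines up to the count of the frequencies
which a translation by `η` moves out of the frequency set. -/
theorem lintegral_sq_norm_kernel_mul_sin_sq {𝒟 : Set (Space d)} {F : Finset (Space d)}
    (hF : (F : Set (Space d)) = dualLattice b ∩ 𝒟) (y : Space d) {η : Space d}
    (hη : η ∈ dualLattice b) :
    ∫⁻ z, ENNReal.ofReal (‖kernel b 𝒟 y z‖ ^ 2) *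
      ENNReal.ofReal (Real.sin (Real.pi * inner ℝ (z - y) η) ^ 2) ∂(mu b) =
      ENNReal.ofReal ((escape F η).card / 2) := by
  have hint : ∀ w, Integrable
      (fun z => kernel b 𝒟 y z * star (kernel b 𝒟 y z) * character w (y - z)) (mu b) := by
    intro w
    simp_rw [kernel_mul_star_mul_character b hF]
    exact integrable_finsetSum _ fun w _ => integrable_finsetSum _ fun w' _ =>
      integrable_character_sub b _ _
  have hpt : ∀ z, ‖kernel b 𝒟 y z‖ ^ 2 * Real.sin (Real.pi * inner ℝ (z - y) η) ^ 2 =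
      (1 / 2) * (RCLike.re (kernel b 𝒟 y z * star (kernel b 𝒟 y z) * character 0 (y - z)) -
        RCLike.re (kernel b 𝒟 y z * star (kernel b 𝒟 y z) * character η (y - z))) := by
    intro z
    rw [kernel_mul_star]
    simp only [RCLike.re_to_complex, Complex.re_ofReal_mul, re_character]
    have e2 : Real.sin (Real.pi * inner ℝ (z - y) η) ^ 2 =
        Real.sin (Real.pi * inner ℝ (y - z) η) ^ 2 := by
      rw [← neg_sub y z, inner_neg_left, mul_neg, Real.sin_neg, neg_sq]
    rw [e2, mul_assoc 2 Real.pi (inner ℝ (y - z) η), Real.cos_two_mul_eq_one_sub,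
      inner_zero_right, mul_zero, Real.cos_zero]
    ring
  have h1 : ∫ z, ‖kernel b 𝒟 y z‖ ^ 2 * Real.sin (Real.pi * inner ℝ (z - y) η) ^ 2 ∂(mu b) =
      (escape F η).card / 2 := by
    simp_rw [hpt]
    rw [integral_const_mul, integral_sub (hint 0).re (hint η).re, integral_re (hint 0),
      integral_re (hint η), integral_kernel_mul_star_mul_character b hF y (zero_mem_dualLattice b),
      integral_kernel_mul_star_mul_character b hF y hη]
    simp [escape_zero]
    ring
  have h2 : Integrable (fun z => ‖kernel b 𝒟 y z‖ ^ 2 *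
      Real.sin (Real.pi * inner ℝ (z - y) η) ^ 2) (mu b) := by
    simp_rw [hpt]
    exact ((hint 0).re.sub (hint η).re).const_mul _
  rw [← h1, ofReal_integral_eq_lintegral_ofReal h2 (Eventually.of_forall fun z => by positivity)]
  exact lintegral_congr fun z => (ENNReal.ofReal_mul (by positivity)).symm

theorem lintegral_sq_norm_kernel {𝒟 : Set (Space d)} {F : Finset (Space d)}
    (hF : (F : Set (Space d)) = dualLattice b ∩ 𝒟) (y : Space d) :
    ∫⁻ z, ENNReal.ofReal (‖kernel b 𝒟 y z‖ ^ 2) ∂(mu b) = F.card := by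
  have h := integral_kernel_mul_star_mul_character b hF y (zero_mem_dualLattice b)
  have hpt : ∀ z, kernel b 𝒟 y z * star (kernel b 𝒟 y z) * character 0 (y - z) =
      ((‖kernel b 𝒟 y z‖ ^ 2 : ℝ) : ℂ) := fun z => by
    rw [kernel_mul_star]
    simp [character]
  simp_rw [hpt] at h
  rw [integral_complex_ofReal, escape_zero] at h
  rw [← ofReal_integral_eq_lintegral_ofReal]
  · have : ∫ z, ‖kernel b 𝒟 y z‖ ^ 2 ∂(mu b) = F.card := by
      simpa using congrArg Complex.re h
    rw [this, ENNReal.ofReal_natCast]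
  · refine Integrable.of_bound (C := (F.card : ℝ) ^ 2)
      ((continuous_kernel_right b hF y).norm.pow 2).aestronglyMeasurable
      (Eventually.of_forall fun z => ?_)
    rw [norm_pow, norm_norm]
    gcongr
    exact norm_kernel_le b hF y z
  · exact Eventually.of_forall fun z => by positivity

end

/-! ### Second moments of the process -/

section

/-- The index of the cell of side `1 / k` that contains `x`. -/
noncomputable def cellIndex {d : ℕ} (k : ℕ) (x : Space d) (i : Fin d) : ℤ := ⌊(k : ℝ) * x i⌋

theorem measurable_cellIndex {d : ℕ} (k : ℕ) : Measurable (cellIndex (d := d) k) := by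
  refine measurable_pi_lambda _ fun i => Int.measurable_floor.comp ?_
  fun_prop

theorem eventually_cellIndex_ne {d : ℕ} {x y : Space d} (h : x ≠ y) :
    ∀ᶠ k : ℕ in atTop, cellIndex k x ≠ cellIndex k y := by
  obtain ⟨i, hi⟩ : ∃ i, x i ≠ y i := by
    by_contra! hc
    exact h (PiLp.ext hc)
  obtain ⟨K, hK⟩ := exists_nat_gt (1 / |x i - y i|)
  have hpos : 0 < |x i - y i| := abs_pos.2 (sub_ne_zero.2 hi)
  filter_upwards [eventually_ge_atTop K] with k hk hc
  have h1 : |(k : ℝ) * x i - k * y i| < 1 := Int.abs_sub_lt_one_of_floor_eq_floor (congrFun hc i)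
  rw [← mul_sub, abs_mul, Nat.abs_cast] at h1
  rw [div_lt_iff₀ hpos] at hK
  have h2 : (K : ℝ) ≤ k := by exact_mod_cast hk
  nlinarith

theorem eventually_sq_count_le {d : ℕ} (X : Finset (Space d)) (D : Set (Space d)) :
    ∀ᶠ k : ℕ in atTop, (count X D : ℝ≥0∞) ^ 2 ≤ count X D +
      ∑' p : {p : (Fin d → ℤ) × (Fin d → ℤ) // p.1 ≠ p.2},
        (count X (D ∩ cellIndex k ⁻¹' {p.1.1}) : ℝ≥0∞) *
          count X (D ∩ cellIndex k ⁻¹' {p.1.2}) := by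
  classical
  set Y := X.filter (· ∈ D) with hY
  have hcount : count X D = Y.card := by
    rw [count, ← Set.ncard_coe_finset, hY, Finset.coe_filter]
    rfl
  have hsep : ∀ᶠ k : ℕ in atTop, ∀ p ∈ Y.offDiag, cellIndex k p.1 ≠ cellIndex k p.2 :=
    (Finset.eventually_all _).2 fun p hp => eventually_cellIndex_ne (Finset.mem_offDiag.1 hp).2.2
  filter_upwards [hsep] with k hk
  have hinj : ∀ x ∈ Y, ∀ y ∈ Y, cellIndex k x = cellIndex k y → x = y := by
    intro x hx y hy hxy
    by_contra hne
    exact hk (x, y) (Finset.mem_offDiag.2 ⟨hx, hy, hne⟩) hxy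
  have hone : ∀ x ∈ Y, (1 : ℝ≥0∞) ≤ count X (D ∩ cellIndex k ⁻¹' {cellIndex k x}) := by
    intro x hx
    have hx' := Finset.mem_filter.1 hx
    have : 0 < count X (D ∩ cellIndex k ⁻¹' {cellIndex k x}) :=
      (Set.ncard_pos (X.finite_toSet.inter_of_left _)).2 ⟨x, hx'.1, hx'.2, rfl⟩
    exact_mod_cast this
  -- each ordered pair of distinct points occupies a pair of cells of its own
  set g : Y.offDiag → {p : (Fin d → ℤ) × (Fin d → ℤ) // p.1 ≠ p.2} :=
    fun p => ⟨(cellIndex k p.1.1, cellIndex k p.1.2), hk p.1 p.2⟩ with hg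
  have hginj : Function.Injective g := by
    rintro ⟨⟨x, y⟩, hp⟩ ⟨⟨x', y'⟩, hp'⟩ h
    simp only [hg, Subtype.mk.injEq, Prod.mk.injEq] at h
    rw [Finset.mem_offDiag] at hp hp'
    simp only [Subtype.mk.injEq, Prod.mk.injEq]
    exact ⟨hinj _ hp.1 _ hp'.1 h.1, hinj _ hp.2.1 _ hp'.2.1 h.2⟩
  have hcard : (Y.card : ℝ≥0∞) ^ 2 ≤ Y.card + (Y.offDiag.card : ℕ) := by
    have : Y.card ^ 2 ≤ Y.card + Y.offDiag.card := by
      rw [Finset.offDiag_card, sq]; omega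
    exact_mod_cast this
  rw [hcount]
  refine hcard.trans (add_le_add le_rfl ?_)
  refine le_trans ?_ (ENNReal.tsum_comp_le_tsum_of_injective hginj _)
  calc ((Y.offDiag.card : ℕ) : ℝ≥0∞) = ∑' _ : Y.offDiag, (1 : ℝ≥0∞) := by simp
    _ ≤ _ := ENNReal.tsum_le_tsum fun p => by
      have hp := Finset.mem_offDiag.1 p.2
      exact one_le_mul (hone _ hp.1) (hone _ hp.2.1)

/-- For a simple process, the second factorial moment is controlled by the joint intensity on
disjoint sets: the cells of a fine partition eventually separate the points. -/
theorem lintegral_sq_count_le {d : ℕ} {S : Type*} [MeasurableSpace S] {P : Measure S}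
    {X : S → Finset (Space d)}
    (hX : ∀ D : Set (Space d), MeasurableSet D → Measurable fun ω => count (X ω) D)
    {D : Set (Space d)} (hD : MeasurableSet D) {μ : Measure (Space d × Space d)}
    {ρ : Space d × Space d → ℝ≥0∞}
    (hρ : ∀ E E' : Set (Space d), MeasurableSet E → MeasurableSet E' → E ⊆ D → E' ⊆ D →
      Disjoint E E' → ∫⁻ ω, (count (X ω) E : ℝ≥0∞) * count (X ω) E' ∂P =
        ∫⁻ p in E ×ˢ E', ρ p ∂μ) :
    ∫⁻ ω, (count (X ω) D : ℝ≥0∞) ^ 2 ∂P ≤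
      ∫⁻ ω, (count (X ω) D : ℝ≥0∞) ∂P + ∫⁻ p in D ×ˢ D, ρ p ∂μ := by
  have hX' : ∀ D : Set (Space d), MeasurableSet D →
      Measurable fun ω => (count (X ω) D : ℝ≥0∞) := fun D hD =>
    (measurable_of_countable fun n : ℕ => (n : ℝ≥0∞)).comp (hX D hD)
  have hcell : ∀ (k : ℕ) (c : Fin d → ℤ), MeasurableSet (D ∩ cellIndex k ⁻¹' {c}) := fun k c =>
    hD.inter (measurable_cellIndex k (measurableSet_singleton c))
  have hmeas : ∀ k : ℕ, ∀ p : {p : (Fin d → ℤ) × (Fin d → ℤ) // p.1 ≠ p.2},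
      Measurable fun ω => (count (X ω) (D ∩ cellIndex k ⁻¹' {p.1.1}) : ℝ≥0∞) *
          count (X ω) (D ∩ cellIndex k ⁻¹' {p.1.2}) := fun k p =>
    (hX' _ (hcell k _)).mul (hX' _ (hcell k _))
  set T : ℕ → S → ℝ≥0∞ := fun k ω => count (X ω) D +
      ∑' p : {p : (Fin d → ℤ) × (Fin d → ℤ) // p.1 ≠ p.2},
        (count (X ω) (D ∩ cellIndex k ⁻¹' {p.1.1}) : ℝ≥0∞) *
          count (X ω) (D ∩ cellIndex k ⁻¹' {p.1.2}) with hT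
  have hTm : ∀ k, Measurable (T k) := fun k =>
    (hX' D hD).add (Measurable.tsum (hmeas k))
  have hTint : ∀ k, ∫⁻ ω, T k ω ∂P ≤
      ∫⁻ ω, (count (X ω) D : ℝ≥0∞) ∂P + ∫⁻ p in D ×ˢ D, ρ p ∂μ := by
    intro k
    rw [hT, lintegral_add_left (hX' D hD), lintegral_tsum fun p => (hmeas k p).aemeasurable]
    gcongr
    have h1 : ∀ p : {p : (Fin d → ℤ) × (Fin d → ℤ) // p.1 ≠ p.2},
        ∫⁻ ω, (count (X ω) (D ∩ cellIndex k ⁻¹' {p.1.1}) : ℝ≥0∞) *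
          count (X ω) (D ∩ cellIndex k ⁻¹' {p.1.2}) ∂P =
        ∫⁻ q in (D ∩ cellIndex k ⁻¹' {p.1.1}) ×ˢ (D ∩ cellIndex k ⁻¹' {p.1.2}), ρ q ∂μ := by
      intro p
      refine hρ _ _ (hcell k _) (hcell k _) Set.inter_subset_left Set.inter_subset_left ?_
      refine Set.disjoint_left.2 fun x hx hx' => p.2 ?_
      exact (hx.2 : cellIndex k x = _).symm.trans hx'.2
    rw [tsum_congr h1, ← lintegral_iUnion]
    · exact lintegral_mono_set (Set.iUnion_subset fun p =>
        Set.prod_mono Set.inter_subset_left Set.inter_subset_left)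
    · exact fun p => (hcell k _).prod (hcell k _)
    · intro p p' hpp
      refine Set.disjoint_left.2 fun x hx hx' => hpp (Subtype.ext (Prod.ext ?_ ?_))
      · exact (hx.1.2 : cellIndex k x.1 = _).symm.trans hx'.1.2
      · exact (hx.2.2 : cellIndex k x.2 = _).symm.trans hx'.2.2
  calc ∫⁻ ω, (count (X ω) D : ℝ≥0∞) ^ 2 ∂P
      ≤ ∫⁻ ω, liminf (fun k => T k ω) atTop ∂P :=
        lintegral_mono fun ω => le_liminf_of_le (by isBoundedDefault)
          (eventually_sq_count_le (X ω) D)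
    _ ≤ liminf (fun k => ∫⁻ ω, T k ω ∂P) atTop := lintegral_liminf_le hTm
    _ ≤ limsup (fun k => ∫⁻ ω, T k ω ∂P) atTop := liminf_le_limsup
    _ ≤ _ := limsup_le_of_le (by isBoundedDefault) (Eventually.of_forall hTint)

variable {d : ℕ} (b : Module.Basis (Fin d) ℝ (Space d))

theorem kernel_swap {𝒟 : Set (Space d)} {F : Finset (Space d)}
    (hF : (F : Set (Space d)) = dualLattice b ∩ 𝒟) (x y : Space d) :
    kernel b 𝒟 y x = star (kernel b 𝒟 x y) := by
  rw [kernel_eq_sum b hF, kernel_eq_sum b hF, star_sum]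
  refine Finset.sum_congr rfl fun w _ => ?_
  rw [star_character, character, character, ← neg_sub x y, inner_neg_left, inner_neg_right]

theorem kernel_self {𝒟 : Set (Space d)} {F : Finset (Space d)}
    (hF : (F : Set (Space d)) = dualLattice b ∩ 𝒟) (x : Space d) :
    kernel b 𝒟 x x = F.card := by
  rw [kernel_eq_sum b hF]
  simp [character]

section Determinantal

variable {𝒟 : Set (Space d)} {F : Finset (Space d)} {S : Type*} [MeasurableSpace S]
  {P : Measure S} {X : S → Finset (Space d)}

theorem lintegral_count (hF : (F : Set (Space d)) = dualLattice b ∩ 𝒟)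
    (hX : IsDeterminantal b (kernel b 𝒟) P X) {D : Set (Space d)} (hD : MeasurableSet D)
    (hDΩ : D ⊆ Omega b) : ∫⁻ ω, (count (X ω) D : ℝ≥0∞) ∂P = F.card * mu b D := by
  obtain ⟨ρ, hρ1, hρ2⟩ := hX.intensity 1 le_rfl
  have h := hρ2 (fun _ => D) (fun _ => hD) Subsingleton.pairwise
  simp only [Fin.prod_univ_one] at h
  rw [h, setLIntegral_congr_fun (g := fun _ => (F.card : ℝ≥0∞))
    (MeasurableSet.univ_pi fun _ => hD)]
  · rw [setLIntegral_const, Measure.pi_pi, Fin.prod_univ_one]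
  · intro x hx
    have h1 := hρ1 x fun i => hDΩ (hx i trivial)
    rw [Matrix.det_fin_one, Matrix.of_apply, kernel_self b hF] at h1
    have h2 : (F.card : ℝ) = ρ x := by exact_mod_cast h1
    have h3 : ((F.card : ℕ) : ℝ≥0) = ρ x := by exact_mod_cast h2
    change (ρ x : ℝ≥0∞) = _
    rw [← h3]
    simp

theorem lintegral_count_mul_count (hF : (F : Set (Space d)) = dualLattice b ∩ 𝒟)
    (hX : IsDeterminantal b (kernel b 𝒟) P X) {E E' : Set (Space d)} (hE : MeasurableSet E)
    (hE' : MeasurableSet E') (hEΩ : E ⊆ Omega b) (hEΩ' : E' ⊆ Omega b) (hdis : Disjoint E E') :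
    ∫⁻ ω, (count (X ω) E : ℝ≥0∞) * count (X ω) E' ∂P =
      ∫⁻ p in E ×ˢ E', ENNReal.ofReal ((F.card : ℝ) ^ 2 - ‖kernel b 𝒟 p.1 p.2‖ ^ 2)
        ∂((mu b).prod (mu b)) := by
  obtain ⟨ρ, hρ1, hρ2⟩ := hX.intensity 2 one_le_two
  have h := hρ2 ![E, E'] (by simp [Fin.forall_fin_two, hE, hE']) (by
    intro i j hij
    fin_cases i <;> fin_cases j <;> simp_all [hdis.symm])
  simp only [Fin.prod_univ_two, Matrix.cons_val_zero, Matrix.cons_val_one] at h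
  have hpre : (Set.univ.pi ![E, E']) =
      (MeasurableEquiv.finTwoArrow (α := Space d)) ⁻¹' (E ×ˢ E') := by
    ext x
    simp [Set.mem_pi, Fin.forall_fin_two]
  rw [h, ← (measurePreserving_finTwoArrow (mu b)).setLIntegral_comp_preimage_emb
    (MeasurableEquiv.measurableEmbedding _), ← hpre]
  refine setLIntegral_congr_fun (MeasurableSet.univ_pi (by simp [Fin.forall_fin_two, hE, hE'])) ?_
  intro x hx
  have hx0 : x 0 ∈ E := hx 0 trivial
  have hx1 : x 1 ∈ E' := hx 1 trivial
  have h1 := hρ1 x (Fin.forall_fin_two.2 ⟨hEΩ hx0, hEΩ' hx1⟩)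
  rw [Matrix.det_fin_two] at h1
  simp only [Matrix.of_apply] at h1
  rw [kernel_self b hF, kernel_self b hF, kernel_swap b hF (x 0) (x 1), kernel_mul_star] at h1
  have h2 : (F.card : ℝ) ^ 2 - ‖kernel b 𝒟 (x 0) (x 1)‖ ^ 2 = ρ x := by
    rw [sq]; exact_mod_cast h1
  change (ρ x : ℝ≥0∞) = ENNReal.ofReal (_ - ‖kernel b 𝒟 (x 0) (x 1)‖ ^ 2)
  rw [h2, ENNReal.ofReal_coe_nnreal]

/-- The variance of the number of points in `D` is at most the integral of the squared kernel
over the pairs of points that `D` separates. This is where it matters that the kernel is the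
kernel of a projection. -/
theorem lintegral_count_sub_sq_le [IsProbabilityMeasure P]
    (hF : (F : Set (Space d)) = dualLattice b ∩ 𝒟)
    (hX : IsDeterminantal b (kernel b 𝒟) P X) {D : Set (Space d)} (hD : MeasurableSet D)
    (hDΩ : D ⊆ Omega b) :
    ∫⁻ ω, ENNReal.ofReal (((count (X ω) D : ℝ) - (F.card : ℝ) * (mu b).real D) ^ 2) ∂P ≤
      ∫⁻ p in D ×ˢ Dᶜ, ENNReal.ofReal (‖kernel b 𝒟 p.1 p.2‖ ^ 2) ∂((mu b).prod (mu b)) := by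
  set K : Space d × Space d → ℝ≥0∞ := fun p => ENNReal.ofReal (‖kernel b 𝒟 p.1 p.2‖ ^ 2) with hK
  have hKm : Measurable K :=
    (((continuous_kernel b hF).norm.pow 2).measurable).ennreal_ofReal
  set m : ℝ := (F.card : ℝ) * (mu b).real D with hm
  have hm0 : 0 ≤ m := by positivity
  have hmE : (F.card : ℝ≥0∞) * mu b D = ENNReal.ofReal m := by
    rw [hm, ENNReal.ofReal_mul (by positivity), ENNReal.ofReal_natCast, measureReal_def,
      ENNReal.ofReal_toReal (measure_ne_top _ _)]
  have hcm : Measurable fun ω => (count (X ω) D : ℝ≥0∞) :=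
    (measurable_of_countable fun n : ℕ => (n : ℝ≥0∞)).comp (hX.simple.measurable_count D hD)
  have h1 := lintegral_count b hF hX hD hDΩ
  have h2 := lintegral_sq_count_le (P := P) hX.simple.measurable_count hD
    fun E E' hE hE' hED hED' hdis => lintegral_count_mul_count b hF hX hE hE' (hED.trans hDΩ)
      (hED'.trans hDΩ) hdis
  rw [h1, hmE] at h2
  have hJ : ∫⁻ p in D ×ˢ D, K p ∂((mu b).prod (mu b)) +
      ∫⁻ p in D ×ˢ Dᶜ, K p ∂((mu b).prod (mu b)) = ENNReal.ofReal m := by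
    rw [← lintegral_union (hD.prod hD.compl) (Set.disjoint_prod.2 (Or.inr disjoint_compl_right)),
      ← Set.prod_union, Set.union_compl_self, ← Measure.prod_restrict,
      Measure.restrict_univ, lintegral_prod _ hKm.aemeasurable]
    simp only [hK]
    rw [lintegral_congr fun y => lintegral_sq_norm_kernel b hF y, setLIntegral_const, hmE]
  have hI : ∫⁻ p in D ×ˢ D, ENNReal.ofReal ((F.card : ℝ) ^ 2 - ‖kernel b 𝒟 p.1 p.2‖ ^ 2)
      ∂((mu b).prod (mu b)) + ∫⁻ p in D ×ˢ D, K p ∂((mu b).prod (mu b)) =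
      ENNReal.ofReal m ^ 2 := by
    rw [← lintegral_add_right _ hKm]
    have : ∀ p : Space d × Space d,
        ENNReal.ofReal ((F.card : ℝ) ^ 2 - ‖kernel b 𝒟 p.1 p.2‖ ^ 2) + K p =
          (F.card : ℝ≥0∞) ^ 2 := by
      intro p
      have := norm_kernel_le b hF p.1 p.2
      rw [hK, ← ENNReal.ofReal_add (sub_nonneg.2 (by gcongr)) (by positivity), sub_add_cancel,
        ENNReal.ofReal_pow (by positivity), ENNReal.ofReal_natCast]
    simp_rw [this]
    rw [setLIntegral_const, Measure.prod_prod, ← hmE]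
    ring
  have hL : ∫⁻ ω, ENNReal.ofReal (((count (X ω) D : ℝ) - m) ^ 2) ∂P +
      2 * ENNReal.ofReal m * ENNReal.ofReal m =
      ∫⁻ ω, (count (X ω) D : ℝ≥0∞) ^ 2 ∂P + ENNReal.ofReal m ^ 2 := by
    have e1 : ∫⁻ ω, 2 * ENNReal.ofReal m * (count (X ω) D : ℝ≥0∞) ∂P =
        2 * ENNReal.ofReal m * ENNReal.ofReal m := by
      rw [lintegral_const_mul _ hcm, h1, hmE]
    have e2 : ∫⁻ ω, (count (X ω) D : ℝ≥0∞) ^ 2 + ENNReal.ofReal m ^ 2 ∂P =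
        ∫⁻ ω, (count (X ω) D : ℝ≥0∞) ^ 2 ∂P + ENNReal.ofReal m ^ 2 := by
      rw [lintegral_add_right _ measurable_const, lintegral_const, measure_univ, mul_one]
    rw [← e1, ← e2, ← lintegral_add_right _ (hcm.const_mul _)]
    refine lintegral_congr fun ω => ?_
    have e3 : (2 : ℝ≥0∞) * ENNReal.ofReal m * (count (X ω) D : ℝ≥0∞) =
        ENNReal.ofReal (2 * m * count (X ω) D) := by
      rw [ENNReal.ofReal_mul (p := 2 * m) (by positivity), ENNReal.ofReal_mul (p := 2) (by simp),
        ENNReal.ofReal_ofNat, ENNReal.ofReal_natCast]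
    have e4 : (count (X ω) D : ℝ≥0∞) ^ 2 + ENNReal.ofReal m ^ 2 =
        ENNReal.ofReal ((count (X ω) D : ℝ) ^ 2 + m ^ 2) := by
      rw [ENNReal.ofReal_add (by positivity) (by positivity), ENNReal.ofReal_pow (by positivity),
        ENNReal.ofReal_pow hm0, ENNReal.ofReal_natCast]
    rw [e3, e4, ← ENNReal.ofReal_add (by positivity) (by positivity)]
    congr 1
    ring
  have hfin : ∫⁻ p in D ×ˢ D, K p ∂((mu b).prod (mu b)) ≠ ∞ :=
    ne_top_of_le_ne_top ENNReal.ofReal_ne_top (le_self_add.trans hJ.le)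
  have hfin2 : 2 * ENNReal.ofReal m * ENNReal.ofReal m ≠ ∞ :=
    ENNReal.mul_ne_top (ENNReal.mul_ne_top (by simp) ENNReal.ofReal_ne_top) ENNReal.ofReal_ne_top
  refine (ENNReal.add_le_add_iff_right (ENNReal.add_ne_top.2 ⟨hfin2, hfin⟩)).1 ?_
  rw [← add_assoc, hL]
  grw [h2]
  generalize ∫⁻ p in D ×ˢ D, K p ∂((mu b).prod (mu b)) = J at *
  generalize ∫⁻ p in D ×ˢ Dᶜ, K p ∂((mu b).prod (mu b)) = J' at *
  generalize ENNReal.ofReal m = a at *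
  generalize ∫⁻ p in D ×ˢ D, ENNReal.ofReal ((F.card : ℝ) ^ 2 - ‖kernel b 𝒟 p.1 p.2‖ ^ 2)
      ∂((mu b).prod (mu b)) = I at *
  refine le_of_eq ?_
  calc a + I + a ^ 2 + J = a + a ^ 2 + (I + J) := by ring
    _ = (J + J') + a ^ 2 + a ^ 2 := by rw [hI, hJ]
    _ = J' + (2 * a * a + J) := by ring

end Determinantal

end

/-! ### The bound on the number variance -/

section

variable {d : ℕ} (b : Module.Basis (Fin d) ℝ (Space d))

/-- The variance bound for a single ball, integrated over its centre by Tonelli's theorem. -/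
theorem numberVariance_le_lintegral {𝒟 : Set (Space d)} {F : Finset (Space d)} {S : Type*}
    [MeasurableSpace S] {P : Measure S} [IsProbabilityMeasure P] {X : S → Finset (Space d)}
    (hF : (F : Set (Space d)) = dualLattice b ∩ 𝒟)
    (hX : IsDeterminantal b (kernel b 𝒟) P X) (R : ℝ) :
    numberVariance b P X F.card R ≤
      ∫⁻ y, ∫⁻ z, ENNReal.ofReal (‖kernel b 𝒟 y z‖ ^ 2) *
        mu b {x | y ∈ torusBall b x R ∧ z ∉ torusBall b x R} ∂(mu b) ∂(mu b) := by
  have hKm : Measurable fun p : Space d × Space d => ENNReal.ofReal (‖kernel b 𝒟 p.1 p.2‖ ^ 2) :=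
    (((continuous_kernel b hF).norm.pow 2).measurable).ennreal_ofReal
  set A : Set (Space d × (Space d × Space d)) :=
    {q | q.2.1 ∈ torusBall b q.1 R ∧ q.2.2 ∉ torusBall b q.1 R} with hA
  have hAm : MeasurableSet A := by
    refine MeasurableSet.inter ?_ (MeasurableSet.compl ?_)
    · exact (measurable_fst.prodMk (measurable_fst.comp measurable_snd))
        (measurableSet_mem_torusBall b R)
    · exact (measurable_fst.prodMk (measurable_snd.comp measurable_snd))
        (measurableSet_mem_torusBall b R)
  have hKA : Measurable (A.indicator fun q => ENNReal.ofReal (‖kernel b 𝒟 q.2.1 q.2.2‖ ^ 2)) :=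
    (hKm.comp measurable_snd).indicator hAm
  calc numberVariance b P X F.card R
      ≤ ∫⁻ x, ∫⁻ p in torusBall b x R ×ˢ (torusBall b x R)ᶜ,
          ENNReal.ofReal (‖kernel b 𝒟 p.1 p.2‖ ^ 2) ∂((mu b).prod (mu b)) ∂(mu b) :=
        lintegral_mono fun x => lintegral_count_sub_sq_le b hF hX (measurableSet_torusBall b x R)
          fun y hy => hy.1
    _ = ∫⁻ x, ∫⁻ p, A.indicator (fun q => ENNReal.ofReal (‖kernel b 𝒟 q.2.1 q.2.2‖ ^ 2)) (x, p)
          ∂((mu b).prod (mu b)) ∂(mu b) := by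
        refine lintegral_congr fun x => ?_
        rw [← lintegral_indicator
          ((measurableSet_torusBall b x R).prod (measurableSet_torusBall b x R).compl)]
        rfl
    _ = ∫⁻ p, ∫⁻ x, A.indicator (fun q => ENNReal.ofReal (‖kernel b 𝒟 q.2.1 q.2.2‖ ^ 2)) (x, p)
          ∂(mu b) ∂((mu b).prod (mu b)) := lintegral_lintegral_swap hKA.aemeasurable
    _ = ∫⁻ p, ENNReal.ofReal (‖kernel b 𝒟 p.1 p.2‖ ^ 2) *
          mu b {x | p.1 ∈ torusBall b x R ∧ p.2 ∉ torusBall b x R} ∂((mu b).prod (mu b)) := by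
        refine lintegral_congr fun p => ?_
        have hm : MeasurableSet {x | p.1 ∈ torusBall b x R ∧ p.2 ∉ torusBall b x R} :=
          measurable_prodMk_right (y := p) hAm
        rw [← lintegral_indicator_const hm]
        rfl
    _ = _ := by
        refine lintegral_prod _ (hKm.mul ?_).aemeasurable
        exact measurable_measure_prodMk_right hAm

/-- The bound on the number variance in terms of the dimensionless radius `n R`, where
`n = N ^ (1 / d)`, from which all three regimes follow. -/
theorem exists_numberVariance_le (hd : 1 ≤ d) {c₀ c₁ : ℝ} (hc₀ : 0 < c₀) (hc₁ : 0 < c₁) :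
    ∃ C : ℝ, 0 < C ∧ ∀ n : ℝ, 1 ≤ n → ∀ N : ℕ, (N : ℝ) = n ^ d → ∀ 𝒟 : Set (Space d),
      Metric.ball 0 (c₀ * n) ⊆ 𝒟 → 𝒟 ⊆ Metric.ball 0 (c₀ * n + c₁) →
      (dualLattice b ∩ 𝒟).ncard = N → ∀ {S : Type*} [MeasurableSpace S] (P : Measure S)
      [IsProbabilityMeasure P] (X : S → Finset (Space d)),
      IsDeterminantal b (kernel b 𝒟) P X → ∀ R : ℝ, 0 < R →
      numberVariance b P X N R ≤
        ENNReal.ofReal (C * ((n * R) ^ (d - 1) * (1 + Real.log (max 1 (n * R))))) := by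
  obtain ⟨C₁, hC₁, h₁⟩ := exists_mu_torusBall_separates_le_tsum b hd
  obtain ⟨C₂, hC₂, h₂⟩ := exists_card_escape_le b hd hc₀ hc₁
  have hd0 : (0 : ℝ) < d := by exact_mod_cast hd
  refine ⟨7 * C₁ * C₂ * d, by positivity, ?_⟩
  intro n hn N hN 𝒟 hD1 hD2 hcard S _ P _ X hX R hR
  have hNpos : 0 < N := by
    have : (0 : ℝ) < N := by rw [hN]; positivity
    exact_mod_cast this
  -- an infinite set has `ncard` zero, which `N > 0` excludes
  have hfin : (dualLattice b ∩ 𝒟).Finite := Set.finite_of_ncard_pos (hcard ▸ hNpos)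
  obtain ⟨F, hF⟩ := hfin.exists_finset_coe
  have hFN : F.card = N := by rw [← hcard, ← hF, Set.ncard_coe_finset]
  subst hFN
  set R' := min R (1 / 2) with hR'
  have hR'0 : 0 < R' := lt_min hR (by norm_num)
  set ℓ := Real.log (max 1 (n * R)) with hℓ
  have hℓ0 : 0 ≤ ℓ := Real.log_nonneg (le_max_left _ _)
  have hn0 : 0 < n := by linarith
  set s : Fin d → ℕ → Space d → Space d → ℝ≥0∞ := fun j m y z =>
    ENNReal.ofReal (Real.sin (Real.pi * inner ℝ (z - y) ((m : ℝ) • dualVector b j)) ^ 2) with hs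
  have hKm : ∀ y, Measurable fun z => ENNReal.ofReal (‖kernel b 𝒟 y z‖ ^ 2) := fun y =>
    (((continuous_kernel_right b hF y).norm.pow 2).measurable).ennreal_ofReal
  have hsm : ∀ j m y, Measurable (s j m y) := fun j m y =>
    Measurable.ennreal_ofReal (Continuous.measurable (by fun_prop))
  -- the inner integral does not depend on `y`
  have hinner : ∀ y, ∫⁻ z, ENNReal.ofReal (‖kernel b 𝒟 y z‖ ^ 2) *
      mu b {x | y ∈ torusBall b x R ∧ z ∉ torusBall b x R} ∂(mu b) ≤
      ENNReal.ofReal (7 * C₁ * C₂ * d * ((n * R) ^ (d - 1) * (1 + ℓ))) := by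
    intro y
    calc _ ≤ ∫⁻ z, ENNReal.ofReal (C₁ * R ^ (d - 1)) * ∑ j, ∑' m : ℕ,
          ENNReal.ofReal (truncCoeff R' m) *
            (ENNReal.ofReal (‖kernel b 𝒟 y z‖ ^ 2) * s j m y z) ∂(mu b) := by
          refine lintegral_mono_ae ?_
          filter_upwards [ae_mem_Omega b] with z hz
          calc _ ≤ ENNReal.ofReal (‖kernel b 𝒟 y z‖ ^ 2) *
                (ENNReal.ofReal (C₁ * R ^ (d - 1)) * ∑ j, ∑' m : ℕ,
                  ENNReal.ofReal (truncCoeff R' m) * s j m y z) := by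
                gcongr
                exact h₁ R hR.le y z hz
            _ = _ := by
                rw [mul_left_comm, Finset.mul_sum]
                congr 1
                refine Finset.sum_congr rfl fun j _ => ?_
                rw [← ENNReal.tsum_mul_left]
                exact tsum_congr fun m => mul_left_comm _ _ _
      _ = ENNReal.ofReal (C₁ * R ^ (d - 1)) * ∑ j, ∑' m : ℕ,
          ENNReal.ofReal (truncCoeff R' m) *
            ENNReal.ofReal ((escape F ((m : ℝ) • dualVector b j)).card / 2) := by
          have hm1 : ∀ j m, Measurable fun z => ENNReal.ofReal (truncCoeff R' m) *
            (ENNReal.ofReal (‖kernel b 𝒟 y z‖ ^ 2) * s j m y z) := fun j m =>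
              ((hKm y).mul (hsm j m y)).const_mul _
          rw [lintegral_const_mul _ (Finset.measurable_fun_sum _ fun j _ =>
            Measurable.tsum (hm1 j)), lintegral_finsetSum _ fun j _ => Measurable.tsum (hm1 j)]
          congr 1
          refine Finset.sum_congr rfl fun j _ => ?_
          rw [lintegral_tsum fun m => (hm1 j m).aemeasurable]
          refine tsum_congr fun m => ?_
          rw [lintegral_const_mul' _ _ ENNReal.ofReal_ne_top,
            lintegral_sq_norm_kernel_mul_sin_sq b hF y (smul_dualVector_mem_dualLattice b m j)]
      _ ≤ ENNReal.ofReal (C₁ * R ^ (d - 1)) * ∑ j : Fin d,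
          ENNReal.ofReal (7 * C₂ * n ^ (d - 1) * (1 + ℓ)) := by
          gcongr with j _
          refine ENNReal.tsum_le_of_sum_range_le fun M => ?_
          simp_rw [← ENNReal.ofReal_mul (truncCoeff_nonneg _ _)]
          rw [← ENNReal.ofReal_sum_of_nonneg fun m _ =>
            mul_nonneg (truncCoeff_nonneg _ _) (by positivity)]
          refine ENNReal.ofReal_le_ofReal ?_
          have h3 := sum_range_truncCoeff_mul_min_le hR'0 (min_le_right _ _) hn M
          have h4 : Real.log (max 1 (n * R')) ≤ ℓ := by
            refine Real.log_le_log (by positivity) ?_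
            gcongr
            exact min_le_left _ _
          calc _ ≤ ∑ m ∈ Finset.range M, C₂ * n ^ (d - 1) / 2 *
                (truncCoeff R' m * min (m : ℝ) n) := by
                refine Finset.sum_le_sum fun m _ => ?_
                have h5 := mul_le_mul_of_nonneg_left (h₂ n hn 𝒟 hD1 hD2 F hF hN m j)
                  (truncCoeff_nonneg R' m)
                linarith
            _ = C₂ * n ^ (d - 1) / 2 * ∑ m ∈ Finset.range M, truncCoeff R' m * min (m : ℝ) n := by
                rw [Finset.mul_sum]
            _ ≤ C₂ * n ^ (d - 1) / 2 * (14 * (1 + ℓ)) := by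
                gcongr
                linarith
            _ = _ := by ring
      _ = _ := by
          rw [Finset.sum_const, Finset.card_univ, Fintype.card_fin, nsmul_eq_mul,
            ← ENNReal.ofReal_natCast d, ← ENNReal.ofReal_mul (by positivity),
            ← ENNReal.ofReal_mul (by positivity)]
          congr 1
          rw [mul_pow]
          ring
  calc _ ≤ _ := numberVariance_le_lintegral b hF hX R
    _ ≤ ∫⁻ _, ENNReal.ofReal (7 * C₁ * C₂ * d * ((n * R) ^ (d - 1) * (1 + ℓ))) ∂(mu b) :=
      lintegral_mono hinner
    _ = _ := by rw [lintegral_const, measure_univ, mul_one]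

end

/-! ### The three regimes -/

theorem tendsto_one_add_log_max_div :
    Tendsto (fun s : ℝ => (1 + Real.log (max 1 s)) / s) atTop (𝓝 0) := by
  have h1 : Tendsto (fun s : ℝ => 1 / s + Real.log s / s) atTop (𝓝 (0 + 0)) := by
    refine Tendsto.add ?_ ?_
    · exact tendsto_const_nhds.div_atTop tendsto_id
    · simpa using Real.isLittleO_log_id_atTop.tendsto_div_nhds_zero
  rw [add_zero] at h1
  refine h1.congr' ?_
  filter_upwards [eventually_ge_atTop 1] with s hs
  rw [max_eq_right hs, add_div]

theorem rpow_one_div_pow {d : ℕ} (hd : 1 ≤ d) (N : ℕ) :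
    ((N : ℝ) ^ (1 / (d : ℝ))) ^ d = N := by
  rw [one_div]
  exact Real.rpow_inv_natCast_pow (by positivity) (by omega)

theorem tendsto_rpow_one_div {d : ℕ} (hd : 1 ≤ d) (A : Set ℕ) :
    Tendsto (fun N : ℕ => (N : ℝ) ^ (1 / (d : ℝ))) (toInfinity A) atTop := by
  have h : (0 : ℝ) < 1 / d := by
    have : (0 : ℝ) < d := by exact_mod_cast hd
    positivity
  exact ((tendsto_rpow_atTop h).comp tendsto_natCast_atTop_atTop).mono_left inf_le_left

theorem eventually_toInfinity (A : Set ℕ) : ∀ᶠ N in toInfinity A, N ∈ A ∧ 1 ≤ N :=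
  (eventually_inf_principal.2 (Eventually.of_forall fun _ h => h)).and
    ((eventually_ge_atTop 1).filter_mono inf_le_left)

/-- The number variances `V N R`, `N ∈ A`, are at most `C s ^ (d - 1) (1 + log⁺ s)`, where
`s = N ^ (1 / d) R` is the dimensionless radius. -/
def LogVarianceBound (d : ℕ) (A : Set ℕ) (V : ℕ → ℝ → ℝ≥0∞) (C : ℝ) : Prop :=
  ∀ N ∈ A, 1 ≤ N → ∀ R : ℝ, 0 < R → V N R ≤ ENNReal.ofReal
      (C * (((N : ℝ) ^ (1 / (d : ℝ)) * R) ^ (d - 1) *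
        (1 + Real.log (max 1 ((N : ℝ) ^ (1 / (d : ℝ)) * R)))))

section Bound

variable {d : ℕ} {A : Set ℕ} {V : ℕ → ℝ → ℝ≥0∞} {C : ℝ}

/-- The bound on the number variance relative to `N ^ (1 / d) R` forces `V` to be of smaller order
than the volume as soon as this dimensionless radius tends to infinity. -/
theorem tendsto_div_of_bound (hd : 1 ≤ d) (hC : 0 < C)
    (hV : LogVarianceBound d A V C)
    {r : ℕ → ℝ} (hr : Tendsto (fun N : ℕ => (N : ℝ) ^ (1 / (d : ℝ)) * r N) (toInfinity A) atTop) :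
    Tendsto (fun N : ℕ => V N (r N) / ENNReal.ofReal (((N : ℝ) ^ (1 / (d : ℝ)) * r N) ^ d))
      (toInfinity A) (𝓝 0) := by
  have h1 : Tendsto (fun N : ℕ => ENNReal.ofReal (C *
      ((1 + Real.log (max 1 ((N : ℝ) ^ (1 / (d : ℝ)) * r N))) /
        ((N : ℝ) ^ (1 / (d : ℝ)) * r N)))) (toInfinity A) (𝓝 0) := by
    have := (ENNReal.continuous_ofReal.tendsto _).comp
      ((tendsto_one_add_log_max_div.comp hr).const_mul C)
    rw [mul_zero, ENNReal.ofReal_zero] at this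
    exact this
  refine tendsto_of_tendsto_of_tendsto_of_le_of_le' tendsto_const_nhds h1
    (Eventually.of_forall fun _ => zero_le) ?_
  filter_upwards [eventually_toInfinity A, hr.eventually_gt_atTop 0] with N hN hs
  have hn : (0 : ℝ) < (N : ℝ) ^ (1 / (d : ℝ)) :=
    Real.rpow_pos_of_pos (by exact_mod_cast hN.2) _
  have hR : 0 < r N := pos_of_mul_pos_right hs hn.le
  have h2 := hV N hN.1 hN.2 (r N) hR
  set s := (N : ℝ) ^ (1 / (d : ℝ)) * r N with hs'
  calc V N (r N) / ENNReal.ofReal (s ^ d)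
      ≤ ENNReal.ofReal (C * (s ^ (d - 1) * (1 + Real.log (max 1 s)))) / ENNReal.ofReal (s ^ d) := by
        gcongr
    _ = ENNReal.ofReal (C * ((1 + Real.log (max 1 s)) / s)) := by
        rw [← ENNReal.ofReal_div_of_pos (by positivity)]
        congr 1
        have : s ^ d = s ^ (d - 1) * s := by rw [← pow_succ]; congr 1; omega
        rw [this]
        field_simp

theorem hyperuniformLargeBalls_of_bound (hd : 1 ≤ d) (b : Module.Basis (Fin d) ℝ (Space d))
    (hC : 0 < C)
    (hV : LogVarianceBound d A V C) :
    HyperuniformLargeBalls b A V := by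
  intro R hR
  have hR0 : 0 < R := hR.1
  have h := tendsto_div_of_bound hd hC hV (r := fun _ => R)
    ((tendsto_rpow_one_div hd A).atTop_mul_const hR0)
  have h1 := ENNReal.Tendsto.const_mul (a := ENNReal.ofReal (R ^ d)) h
    (Or.inr ENNReal.ofReal_ne_top)
  rw [mul_zero] at h1
  refine h1.congr fun N => ?_
  have hRd : ENNReal.ofReal (R ^ d) ≠ 0 := by
    rw [Ne, ENNReal.ofReal_eq_zero, not_le]; positivity
  rw [mul_pow, rpow_one_div_pow hd, ENNReal.ofReal_mul (by positivity), ENNReal.ofReal_natCast,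
    mul_comm (N : ℝ≥0∞), ← mul_div_assoc,
    ENNReal.mul_div_mul_left _ _ hRd ENNReal.ofReal_ne_top]

theorem hyperuniformSmallBalls_of_bound (hd : 1 ≤ d) (hC : 0 < C)
    (hV : LogVarianceBound d A V C) :
    HyperuniformSmallBalls d A V := by
  intro r _ hvol
  have : Nonempty (Fin d) := ⟨⟨0, hd⟩⟩
  set B := volume (Metric.ball (0 : Space d) 1) with hB
  have hB0 : B ≠ 0 := (Metric.measure_ball_pos _ _ one_pos).ne'
  have hBt : B ≠ ∞ := measure_ball_lt_top.ne
  have hrpos : ∀ᶠ N in toInfinity A, 0 ≤ r N := by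
    filter_upwards [hvol.eventually (lt_mem_nhds ENNReal.zero_lt_top)] with N hN
    -- a ball of negative radius is empty, which the divergence of the volumes excludes
    by_contra! hneg
    rw [Metric.closedBall_eq_empty.2 hneg, measure_empty, mul_zero] at hN
    exact lt_irrefl _ hN
  have hvol' : ∀ᶠ N : ℕ in toInfinity A,
      (N : ℝ≥0∞) * volume (Metric.closedBall (0 : Space d) (r N)) =
        B * ENNReal.ofReal (((N : ℝ) ^ (1 / (d : ℝ)) * r N) ^ d) := by
    filter_upwards [hrpos] with N hN
    rw [Measure.addHaar_closedBall _ _ hN, finrank_euclideanSpace_fin, mul_pow,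
      rpow_one_div_pow hd, ENNReal.ofReal_mul (by positivity), ENNReal.ofReal_natCast]
    ring
  have hs : Tendsto (fun N : ℕ => (N : ℝ) ^ (1 / (d : ℝ)) * r N) (toInfinity A) atTop := by
    refine tendsto_atTop.2 fun M => ?_
    have h1 : B * ENNReal.ofReal (max M 0 ^ d) < ∞ :=
      ENNReal.mul_lt_top hBt.lt_top ENNReal.ofReal_lt_top
    filter_upwards [hvol.eventually (lt_mem_nhds h1), hvol', hrpos] with N hN hN' hN''
    rw [hN', ENNReal.mul_lt_mul_iff_right hB0 hBt] at hN
    have h2 := (ENNReal.ofReal_lt_ofReal_iff_of_nonneg (by positivity)).1 hN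
    exact (le_max_left _ _).trans (lt_of_pow_lt_pow_left₀ d (by positivity) h2).le
  have h := ENNReal.Tendsto.const_mul (a := B⁻¹) (tendsto_div_of_bound hd hC hV hs)
    (Or.inr (ENNReal.inv_ne_top.2 hB0))
  rw [mul_zero] at h
  refine h.congr' ?_
  filter_upwards [hvol'] with N hN
  simp only [hN]
  rw [ENNReal.div_eq_inv_mul, ENNReal.div_eq_inv_mul, ENNReal.mul_inv (Or.inl hB0) (Or.inl hBt),
    mul_assoc]

theorem thresholdLogBound_of_bound (hC : 0 < C)
    (hV : LogVarianceBound d A V C) :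
    ThresholdLogBound d A V := by
  refine ⟨2 * C, ?_⟩
  filter_upwards [eventually_ge_atTop (Real.exp 1)] with t ht
  have ht1 : 1 ≤ t := (Real.one_le_exp zero_le_one).trans ht
  have hlog : 1 ≤ Real.log t := (Real.le_log_iff_exp_le (by linarith)).2 ht
  refine limsup_le_of_le (by isBoundedDefault) ?_
  filter_upwards [eventually_toInfinity A] with N hN
  have hN0 : (0 : ℝ) < N := by exact_mod_cast hN.2
  have hn : (0 : ℝ) < (N : ℝ) ^ (-(1 / (d : ℝ))) := Real.rpow_pos_of_pos hN0 _
  have h := hV N hN.1 hN.2 (t * (N : ℝ) ^ (-(1 / (d : ℝ)))) (by positivity)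
  have hs : (N : ℝ) ^ (1 / (d : ℝ)) * (t * (N : ℝ) ^ (-(1 / (d : ℝ)))) = t := by
    rw [mul_left_comm, ← Real.rpow_add hN0, add_neg_cancel, Real.rpow_zero, mul_one]
  rw [hs, max_eq_right ht1] at h
  refine h.trans (ENNReal.ofReal_le_ofReal ?_)
  have h2 : 0 ≤ C * t ^ (d - 1) := by positivity
  nlinarith

end Bound

end FlatTorus

theorem theorem5p4 {d : ℕ} (hd : 1 ≤ d)
    -- a lattice of full rank in `ℝ^d`, through a basis
    (b : Module.Basis (Fin d) ℝ (FlatTorus.Space d))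
    -- the infinite set of those `N` for which the process is considered
    (A : Set ℕ) (hA : A.Infinite)
    -- the domains `𝒟_N`
    (c₀ c₁ : ℝ) (hc₀ : 0 < c₀) (hc₁ : 0 < c₁)
    (𝒟 : ℕ → Set (FlatTorus.Space d))
    (h𝒟_open : ∀ N ∈ A, IsOpen (𝒟 N))
    (h𝒟_frontier : ∀ N ∈ A, volume (frontier (𝒟 N)) = 0)
    (h𝒟_inner : ∀ N ∈ A, Metric.ball 0 (c₀ * (N : ℝ) ^ (1 / (d : ℝ))) ⊆ 𝒟 N)
    (h𝒟_outer : ∀ N ∈ A, 𝒟 N ⊆ Metric.ball 0 (c₀ * (N : ℝ) ^ (1 / (d : ℝ)) + c₁))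
    (h𝒟_trace : ∀ N ∈ A, (FlatTorus.dualLattice b ∩ 𝒟 N).ncard = N)
    -- the determinantal point processes `X_N`
    {S : ℕ → Type*} [∀ N, MeasurableSpace (S N)]
    (P : ∀ N, Measure (S N)) [∀ N, IsProbabilityMeasure (P N)]
    (X : ∀ N, S N → Finset (FlatTorus.Space d))
    (hX : ∀ N ∈ A, FlatTorus.IsDeterminantal b (FlatTorus.kernel b (𝒟 N)) (P N) (X N)) :
    FlatTorus.HyperuniformLargeBalls b A
        (fun N R => FlatTorus.numberVariance b (P N) (X N) N R) ∧
      FlatTorus.HyperuniformSmallBalls d A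
        (fun N R => FlatTorus.numberVariance b (P N) (X N) N R) ∧
      FlatTorus.ThresholdLogBound d A
        (fun N R => FlatTorus.numberVariance b (P N) (X N) N R) := by
  obtain ⟨C, hC, h⟩ := FlatTorus.exists_numberVariance_le b hd hc₀ hc₁
  have hV : FlatTorus.LogVarianceBound d A
      (fun N R => FlatTorus.numberVariance b (P N) (X N) N R) C := fun N hN hN1 R hR =>
    h _ (Real.one_le_rpow (by exact_mod_cast hN1) (by positivity)) N
      (FlatTorus.rpow_one_div_pow hd N).symm (𝒟 N) (h𝒟_inner N hN) (h𝒟_outer N hN)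
      (h𝒟_trace N hN) (P N) (X N) (hX N hN) R hR
  exact ⟨FlatTorus.hyperuniformLargeBalls_of_bound hd b hC hV,
    FlatTorus.hyperuniformSmallBalls_of_bound hd hC hV,
    FlatTorus.thresholdLogBound_of_bound hC hV⟩
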